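/- Theorem 5 (Baik-Deift-Rains, multi-interval). Let $N\ge 1$. For an $N\times N$ matrix function $a$ with entries in $L^\infty(\mathbf T)$ on the complex unit circle $\mathbf T$, let $a_m=\frac1{2\pi}\int_0^{2\pi}a(e^{i\theta})e^{-im\theta}\,d\theta$ ($m\in\mathbf Z$) be its Fourier coefficients and let $L(a)=(a_{j-k})_{j,k\in\mathbf Z}$ be its block Laurent operator on $\ell^2(\mathbf Z,\mathbf C^N)$. Let $K_1^1$ be the set of those $a$ with $\sum_{m\in\mathbf Z}(|m|+1)\|a_m\|<\infty$, and write $a\in\Phi_r(K_1^1)$ if $a=u_-u_+$ where $u_\pm$ are invertible, $u_-,u_-^{-1}\in K_1^1$ have vanishing Fourier coefficients of positive index, and $u_+,u_+^{-1}\in K_1^1$ have vanishing Fourier coefficients of negative index. On $\ell^2(\mathbf Z,\mathbf C^N)$ let $P$, $Q$, $Q_n$ be the projections onto the coordinates $l\ge 0$, $l<0$, $l\ge n$, respectively, and let $P_{[n,m)}$ be the projection onto the coordinates $l$ with $n\le l<m$, where $m=\infty$ is allowed. Let $0=n_0\le n_1\le\dots\le n_k$ be integers, put $n_{k+1}=\infty$,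 let $s_1,\dots,s_k$ be complex numbers with $s_k-s_j\ne-1$ for $j=1,\dots,k$, and put $s_0=0$. If $a\in\Phi_r(K_1^1)$, then the operators $$\sum_{j=1}^k(s_j-s_{j-1})\bigl(P-L(a)Q_{n_j}L(a^{-1})\bigr)\quad\text{and}\quad \Bigl(\sum_{j=1}^k\frac{s_ks_j}{1+s_k-s_j}P_{[n_j,n_{j+1})}\Bigr)L(a^{-1})QL(a)$$ are trace class, and their Fredholm determinants satisfy $$\det\Bigl(I+\sum_{j=1}^k(s_j-s_{j-1})\bigl(P-L(a)Q_{n_j}L(a^{-1})\bigr)\Bigr)=\Bigl(\prod_{j=0}^{k-1}(1+s_k-s_j)^{N(n_{j+1}-n_j)}\Bigr)\det\Bigl(I-\Bigl(\sum_{j=1}^k\frac{s_ks_j}{1+s_k-s_j}P_{[n_j,n_{j+1})}\Bigr)L(a^{-1})QL(a)\Bigr).$$ -/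

import Mathlib

open Filter Topology MeasureTheory
open scoped ENNReal Matrix InnerProductSpace

noncomputable section

namespace BlockLaurent

/-! ### Matrix functions on the unit circle -/

/-- `N × N` matrix functions on the complex unit circle. The circle is parametrised by
`t ↦ exp (2πit)`, `t ∈ ℝ/ℤ`; it carries normalised Lebesgue (Haar) measure, and equalities between
matrix functions are understood almost everywhere. -/
abbrev MatFun (N : ℕ) : Type := UnitAddCircle → Matrix (Fin N) (Fin N) ℂ

variable {N : ℕ}

/-- The `n`-th Fourier coefficient `a_n`, an `N × N` matrix. -/
def coeff (a : MatFun N) (n : ℤ) : Matrix (Fin N) (Fin N) ℂ :=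
  Matrix.of fun i j => fourierCoeff (fun t => a t i j) n

/-- A norm on `N × N` matrices (all of them are equivalent): the sum of the moduli of the
entries. -/
def matNorm (A : Matrix (Fin N) (Fin N) ℂ) : ℝ := ∑ i, ∑ j, ‖A i j‖

/-- The matrix functions with entries in `L^∞`. -/
def LInf (N : ℕ) : Set (MatFun N) :=
  {a | ∀ i j, MemLp (fun t => a t i j) ∞ (AddCircle.haarAddCircle (T := (1 : ℝ)))}

/-- The weighted Wiener algebra `K_1^1`. -/
def K11 (N : ℕ) : Set (MatFun N) :=
  {a | a ∈ LInf N ∧ Summable fun n : ℤ => (|(n : ℝ)| + 1) * matNorm (coeff a n)}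

/-- The Hardy space `H^∞_+`: Fourier coefficients of negative index vanish. -/
def HInfPlus (N : ℕ) : Set (MatFun N) :=
  {a | a ∈ LInf N ∧ ∀ n : ℤ, 0 < n → coeff a (-n) = 0}

/-- The Hardy space `H^∞_-`: Fourier coefficients of positive index vanish. -/
def HInfMinus (N : ℕ) : Set (MatFun N) :=
  {a | a ∈ LInf N ∧ ∀ n : ℤ, 0 < n → coeff a n = 0}

/-- `Φ_r(E)`: the matrix functions `a ∈ L^∞` with a right canonical Wiener-Hopf factorization
`a = u₋ u₊` in `E`. Inverses are pointwise matrix inverses. -/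
def PhiR (E : Set (MatFun N)) : Set (MatFun N) :=
  {a | a ∈ LInf N ∧ ∃ um up : MatFun N,
    (∀ᵐ t ∂(AddCircle.haarAddCircle (T := (1 : ℝ))), IsUnit (um t)) ∧
    (∀ᵐ t ∂(AddCircle.haarAddCircle (T := (1 : ℝ))), IsUnit (up t)) ∧
    um ∈ E ∩ HInfMinus N ∧ um⁻¹ ∈ E ∩ HInfMinus N ∧
    up ∈ E ∩ HInfPlus N ∧ up⁻¹ ∈ E ∩ HInfPlus N ∧
    ∀ᵐ t ∂(AddCircle.haarAddCircle (T := (1 : ℝ))), a t = um t * up t}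

/-! ### Operators on `ℓ²(ℤ, ℂ^N)` -/

/-- The Hilbert space `ℓ²(ℤ, ℂ^N)`. -/
abbrev Ell2 (N : ℕ) : Type := lp (fun _ : ℤ => EuclideanSpace ℂ (Fin N)) 2

/-- The coordinate projection onto the block coordinates `k ∈ S`. -/
def coordProj (S : Set ℤ) : Ell2 N →L[ℂ] Ell2 N :=
  haveI := Classical.decPred (· ∈ S)
  lp.mapCLM 2 (fun k : ℤ => if k ∈ S then ContinuousLinearMap.id ℂ (EuclideanSpace ℂ (Fin N)) else 0)
    zero_le_one (fun k => by
      split_ifs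
      · exact ContinuousLinearMap.norm_id_le
      · simp)

open Classical in
theorem coordProj_apply (S : Set ℤ) (x : Ell2 N) (k : ℤ) :
    coordProj S x k = if k ∈ S then x k else 0 := by
  simp only [coordProj, lp.mapCLM_apply_coe]
  split_ifs <;> simp

/-- `P`: projection onto the coordinates `k ≥ 0`. -/
def P : Ell2 N →L[ℂ] Ell2 N := coordProj {k | 0 ≤ k}

/-- `Q`: projection onto the coordinates `k < 0`. -/
def Q : Ell2 N →L[ℂ] Ell2 N := coordProj {k | k < 0}

/-- `Q_n`: projection onto the coordinates `k ≥ n`. -/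
def Qn (n : ℤ) : Ell2 N →L[ℂ] Ell2 N := coordProj {k | n ≤ k}

/-- For `n_0, …, n_k` and `n_{k+1} = ∞`: the integers `l` with `n_j ≤ l < n_{j+1}`. -/
def interval {k : ℕ} (n : Fin (k + 1) → ℕ) (j : Fin (k + 1)) : Set ℤ :=
  {l | (n j : ℤ) ≤ l ∧ ∀ i : Fin (k + 1), (i : ℕ) = (j : ℕ) + 1 → l < (n i : ℤ)}

/-- `P_{[n_j, n_{j+1})}`, where `n_{k+1} = ∞`. -/
def intervalProj {k : ℕ} (n : Fin (k + 1) → ℕ) (j : Fin (k + 1)) : Ell2 N →L[ℂ] Ell2 N :=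
  coordProj (interval n j)

/-- `T` is the bounded operator given by the block Laurent matrix `(a_{j-k})_{j,k ∈ ℤ}`. -/
def IsLaurent (a : MatFun N) (T : Ell2 N →L[ℂ] Ell2 N) : Prop :=
  ∀ (k : ℤ) (v : EuclideanSpace ℂ (Fin N)) (j : ℤ),
    T (lp.single 2 k v) j = Matrix.toEuclideanCLM (n := Fin N) (𝕜 := ℂ) (coeff a (j - k)) v

/-- A bounded operator is determined by its block matrix. -/
theorem IsLaurent.unique {a : MatFun N} {T T' : Ell2 N →L[ℂ] Ell2 N}
    (h : IsLaurent a T) (h' : IsLaurent a T') : T = T' := by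
  refine lp.ext_continuousLinearMap (by norm_num) fun k => ?_
  ext1 v
  apply lp.ext
  funext j
  exact (h k v j).trans (h' k v j).symm

theorem exists_shift (m : ℤ) : ∃ U : Ell2 N →L[ℂ] Ell2 N, ‖U‖ ≤ 1 ∧ ∀ x j, U x j = x (j - m) := by
  have h2 : (0 : ℝ) < (2 : ℝ≥0∞).toReal := by norm_num
  have key : ∀ x : Ell2 N, Summable fun j : ℤ => ‖x (j - m)‖ ^ (2 : ℝ≥0∞).toReal := fun x =>
    (Equiv.subRight m).summable_iff.mpr ((lp.memℓp x).summable h2)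
  let U₀ : Ell2 N →ₗ[ℂ] Ell2 N :=
    { toFun := fun x => ⟨fun j => x (j - m), memℓp_gen (key x)⟩
      map_add' := fun x y => rfl
      map_smul' := fun c x => rfl }
  refine ⟨U₀.mkContinuous 1 fun x => ?_, LinearMap.mkContinuous_norm_le _ zero_le_one _,
    fun x j => rfl⟩
  rw [one_mul]
  refine lp.norm_le_of_tsum_le h2 (norm_nonneg _) ?_
  rw [lp.norm_rpow_eq_tsum h2 x]
  exact le_of_eq ((Equiv.subRight m).tsum_eq fun j => ‖x j‖ ^ (2 : ℝ≥0∞).toReal)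

theorem norm_toEuclideanCLM_le (A : Matrix (Fin N) (Fin N) ℂ) :
    ‖Matrix.toEuclideanCLM (n := Fin N) (𝕜 := ℂ) A‖ ≤ matNorm A := by
  have h0 : 0 ≤ matNorm A := Finset.sum_nonneg fun i _ => Finset.sum_nonneg fun j _ => norm_nonneg _
  refine ContinuousLinearMap.opNorm_le_bound _ h0 fun v => ?_
  have hv : ∀ w : EuclideanSpace ℂ (Fin N), ‖w‖ ≤ ∑ i, ‖w i‖ := fun w => by
    calc ‖w‖ = ‖∑ i, EuclideanSpace.single i (w i)‖ := by
          congr 1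
          ext j
          simp [Finset.sum_apply, Pi.single_apply]
      _ ≤ ∑ i, ‖EuclideanSpace.single i (w i)‖ := norm_sum_le _ _
      _ = ∑ i, ‖w i‖ := by simp
  refine (hv _).trans ?_
  rw [matNorm, Finset.sum_mul]
  refine Finset.sum_le_sum fun i _ => ?_
  rw [Finset.sum_mul, Matrix.ofLp_toEuclideanCLM, Matrix.mulVec, dotProduct]
  refine (norm_sum_le _ _).trans (Finset.sum_le_sum fun j _ => ?_)
  rw [norm_mul]
  exact mul_le_mul_of_nonneg_left (PiLp.norm_apply_le v j) (norm_nonneg _)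

/-- The block Laurent matrix of a matrix function with absolutely summable Fourier coefficients is
the matrix of a bounded operator. -/
theorem exists_isLaurent {a : MatFun N} (ha : Summable fun n : ℤ => matNorm (coeff a n)) :
    ∃ T, IsLaurent a T := by
  choose U hU1 hU using exists_shift (N := N)
  let A : ℤ → EuclideanSpace ℂ (Fin N) →L[ℂ] EuclideanSpace ℂ (Fin N) := fun m =>
    Matrix.toEuclideanCLM (n := Fin N) (𝕜 := ℂ) (coeff a m)
  let M : ℤ → Ell2 N →L[ℂ] Ell2 N := fun m =>
    lp.mapCLM 2 (fun _ : ℤ => A m) (norm_nonneg (A m)) (fun _ => le_rfl)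
  have hs : Summable fun m => M m ∘L U m := by
    refine Summable.of_norm_bounded ha fun m => ?_
    calc ‖M m ∘L U m‖ ≤ ‖M m‖ * ‖U m‖ := ContinuousLinearMap.opNorm_comp_le _ _
      _ ≤ ‖A m‖ * 1 := mul_le_mul (lp.norm_mapCLM_le 2 _ _ _) (hU1 m) (norm_nonneg _)
          (norm_nonneg _)
      _ ≤ matNorm (coeff a m) := by rw [mul_one]; exact norm_toEuclideanCLM_le _
  refine ⟨∑' m, M m ∘L U m, fun k v j => ?_⟩
  have h1 := (hs.hasSum.mapL (ContinuousLinearMap.apply ℂ (Ell2 N) (lp.single 2 k v))).mapL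
    (lp.evalCLM ℂ (fun _ : ℤ => EuclideanSpace ℂ (Fin N)) 2 j)
  have h2 := hasSum_single (f := fun m : ℤ =>
    (A m) ((lp.single 2 k v : Ell2 N) (j - m))) (j - k) (fun m hm => by
      rw [lp.single_apply_ne, map_zero]
      intro h; apply hm; omega)
  have h3 : ∀ m : ℤ, (A m) ((lp.single 2 k v : Ell2 N) (j - m)) =
      ((M m ∘L U m) (lp.single 2 k v) : Ell2 N) j := fun m =>
    congrArg (A m) (hU m (lp.single 2 k v) j).symm
  have h4 : (A (j - k)) ((lp.single 2 k v : Ell2 N) (j - (j - k))) = A (j - k) v := by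
    have h5 : j - (j - k) = k := by omega
    rw [h5, lp.single_apply_self]
  rw [h4] at h2
  refine h1.unique ?_
  simp only [h3] at h2
  exact h2

open Classical in
/-- The block Laurent operator `L(a)`: the bounded operator on `ℓ²(ℤ, ℂ^N)` given by the matrix
`(a_{j-k})_{j,k ∈ ℤ}`. -/
def L (a : MatFun N) : Ell2 N →L[ℂ] Ell2 N :=
  if h : ∃ T, IsLaurent a T then h.choose else 0

theorem isLaurent_L {a : MatFun N} (h : ∃ T, IsLaurent a T) : IsLaurent a (L a) := by
  rw [L, dif_pos h]
  exact h.choose_spec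

/-! ### Trace class operators and Fredholm determinants -/

/-- Trace class operators on a Hilbert space: the operators `∑ ⟨x_n, ·⟩ y_n` with
`∑ ‖x_n‖ ‖y_n‖ < ∞`. -/
def IsTraceClass {H : Type*} [NormedAddCommGroup H] [InnerProductSpace ℂ H]
    (K : H →L[ℂ] H) : Prop :=
  ∃ x y : ℕ → H, Summable (fun n => ‖x n‖ * ‖y n‖) ∧
    HasSum (fun n => InnerProductSpace.rankOne ℂ (y n) (x n)) K

/-- The standard orthonormal basis of `ℓ²(ℤ, ℂ^N)`. -/
def stdBasis (p : ℤ × Fin N) : Ell2 N := lp.single 2 p.1 (EuclideanSpace.single p.2 1)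

/-- The finite section of the matrix of `T` with respect to the standard basis, over the index
set `S`. -/
def finSection (T : Ell2 N →L[ℂ] Ell2 N) (S : Finset (ℤ × Fin N)) : Matrix S S ℂ :=
  Matrix.of fun p q => ⟪stdBasis p.1, T (stdBasis q.1)⟫_ℂ

/-- `T` differs from the identity by a trace class operator and `d = det T` is its Fredholm
determinant, the limit of the determinants of its finite sections. -/
def HasFredholmDet (T : Ell2 N →L[ℂ] Ell2 N) (d : ℂ) : Prop :=
  IsTraceClass (T - 1) ∧
    Tendsto (fun S : Finset (ℤ × Fin N) => (finSection T S).det) atTop (𝓝 d)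

end BlockLaurent

end

open BlockLaurent

noncomputable section

theorem OrthonormalBasis.norm_det_le {E κ : Type*} [NormedAddCommGroup E] [InnerProductSpace ℂ E]
    [Fintype κ] [DecidableEq κ] (b : OrthonormalBasis κ ℂ E) (v : κ → E) :
    ‖b.toBasis.det v‖ ≤ ∏ i, ‖v i‖ := by
  classical
  have : FiniteDimensional ℂ E := b.toBasis.finiteDimensional_of_finite
  obtain ⟨e⟩ : Nonempty (κ ≃ Fin (Fintype.card κ)) := ⟨Fintype.equivFin κ⟩
  let b' := b.reindex e
  have hdim : Module.finrank ℂ E = Fintype.card (Fin (Fintype.card κ)) := by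
    rw [Module.finrank_eq_card_basis b'.toBasis]
  let w : Fin (Fintype.card κ) → E := v ∘ e.symm
  let g := InnerProductSpace.gramSchmidtOrthonormalBasis hdim w
  have h1 : b.toBasis.det v = b'.toBasis.det w := by
    rw [OrthonormalBasis.reindex_toBasis, Module.Basis.det_reindex]
    congr 1
    ext i; simp [w]
  have h2 : b'.toBasis.det w = b'.toBasis.det g * g.toBasis.det w := by
    simp only [Module.Basis.det_apply]
    rw [← Matrix.det_mul, ← g.coe_toBasis, Module.Basis.toMatrix_mul_toMatrix]
  have h3 : ‖b'.toBasis.det g‖ = 1 := by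
    rw [Module.Basis.det_apply]
    exact CStarRing.norm_of_mem_unitary
      (Matrix.det_of_mem_unitary (b'.toMatrix_orthonormalBasis_mem_unitary g))
  rw [h1, h2, norm_mul, h3, one_mul, InnerProductSpace.gramSchmidtOrthonormalBasis_det, norm_prod]
  have h4 : ∏ i, ‖v i‖ = ∏ i, ‖w i‖ := (e.symm.prod_comp fun i => ‖v i‖).symm
  rw [h4]
  refine Finset.prod_le_prod (fun _ _ => norm_nonneg _) fun i _ => ?_
  refine (norm_inner_le_norm _ _).trans ?_
  simp [OrthonormalBasis.norm_eq_one]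

/-- Hadamard's inequality for mixed Gram matrices. -/
theorem norm_det_inner_le {H κ : Type*} [NormedAddCommGroup H] [InnerProductSpace ℂ H]
    [Fintype κ] [DecidableEq κ] (x y : κ → H) :
    ‖(Matrix.of fun i j => ⟪x i, y j⟫_ℂ).det‖ ≤ (∏ i, ‖x i‖) * ∏ i, ‖y i‖ := by
  by_cases hy : LinearIndependent ℂ y
  · let W := Submodule.span ℂ (Set.range y)
    have : FiniteDimensional ℂ W := FiniteDimensional.span_of_finite ℂ (Set.finite_range y)
    have hfin : Module.finrank ℂ W = Fintype.card κ := finrank_span_eq_card hy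
    let b : OrthonormalBasis κ ℂ W :=
      (stdOrthonormalBasis ℂ W).reindex ((finCongr hfin).trans (Fintype.equivFin κ).symm)
    let y' : κ → W := fun j => ⟨y j, Submodule.subset_span ⟨j, rfl⟩⟩
    let x' : κ → W := fun j => W.orthogonalProjectionOnto (x j)
    have h1 : (Matrix.of fun i j => ⟪x i, y j⟫_ℂ) = (b.toBasis.toMatrix x')ᴴ * b.toBasis.toMatrix
        y' := by
      ext i j
      have : ⟪x i, y j⟫_ℂ = ⟪x' i, y' j⟫_ℂ := by
        exact (Submodule.inner_orthogonalProjectionOnto_eq_of_mem_right (y' j) (x i)).symm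
      simp only [Matrix.of_apply, this, Matrix.mul_apply, Matrix.conjTranspose_apply,
          Module.Basis.toMatrix_apply,
        b.coe_toBasis_repr_apply, b.repr_apply_apply]
      rw [← b.sum_inner_mul_inner]
      simp
    rw [h1, Matrix.det_mul, Matrix.det_conjTranspose, norm_mul, norm_star]
    refine mul_le_mul ((b.norm_det_le x').trans ?_) ((b.norm_det_le y').trans ?_) (norm_nonneg _)
        (Finset.prod_nonneg fun _ _ => norm_nonneg _)
    · exact Finset.prod_le_prod (fun _ _ => norm_nonneg _) fun i _ =>
        W.norm_orthogonalProjectionOnto_apply_le _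
    · exact le_rfl
  · obtain ⟨g, hg, i, hi⟩ := Fintype.not_linearIndependent_iff.mp hy
    have : (Matrix.of fun i j => ⟪x i, y j⟫_ℂ).det = 0 := by
      refine Matrix.exists_mulVec_eq_zero_iff.mp ⟨g, fun h => hi (congrFun h i), ?_⟩
      ext l
      have := congrArg (fun z => ⟪x l, z⟫_ℂ) hg
      simpa [inner_sum, inner_smul_right, Matrix.mulVec, dotProduct, mul_comm] using this
    rw [this, norm_zero]
    positivity

theorem norm_det_one_add_inner_sub_le {H κ : Type*} [NormedAddCommGroup H] [InnerProductSpace ℂ H]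
    [Fintype κ] [DecidableEq κ] (x y : κ → H) (a : κ) :
    ‖(1 + Matrix.of fun i j => ⟪x i, y j⟫_ℂ).det -
      (1 + Matrix.of fun i j => ⟪Function.update x a 0 i, y j⟫_ℂ).det‖ ≤
      ‖x a‖ * ‖y a‖ * Real.exp (∑ i, ‖x i‖ ^ 2 + ∑ i, ‖y i‖ ^ 2) := by
  set M : Matrix κ κ ℂ := 1 + Matrix.of fun i j => ⟪x i, y j⟫_ℂ with hM
  have h1 : M = M.updateRow a ((1 : Matrix κ κ ℂ) a + fun j => ⟪x a, y j⟫_ℂ) := by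
    rw [eq_comm]
    convert Matrix.updateRow_eq_self M a using 2
    rfl
  have h2 : M.updateRow a ((1 : Matrix κ κ ℂ) a) =
      1 + Matrix.of fun i j => ⟪Function.update x a 0 i, y j⟫_ℂ := by
    ext i j
    by_cases hi : i = a
    · subst hi; simp
    · simp [Matrix.updateRow_ne hi, Function.update_of_ne hi, hM]
  let lift : (κ → H) → κ → WithLp 2 (EuclideanSpace ℂ κ × H) := fun x i =>
    WithLp.toLp 2 (if i = a then 0 else EuclideanSpace.single i 1, x i)
  have h3 : M.updateRow a (fun j => ⟪x a, y j⟫_ℂ) =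
      Matrix.of fun i j => ⟪lift x i, lift y j⟫_ℂ := by
    ext i j
    by_cases hi : i = a
    · subst hi; simp [lift]
    · rw [Matrix.updateRow_ne hi]
      by_cases hj : j = a
      · subst hj; simp [lift, hM, hi]
      · simp [lift, hM, hi, hj, Matrix.one_apply, EuclideanSpace.inner_single_left]
  have hn : ∀ (x : κ → H) (i : κ), ‖lift x i‖ ≤ (if i = a then ‖x a‖ else 1) * Real.exp
      (‖x i‖ ^ 2) := by
    intro x i
    have he : 1 ≤ Real.exp (‖x i‖ ^ 2) := Real.one_le_exp (by positivity)
    have h : ‖lift x i‖ ^ 2 = ‖(if i = a then 0 else EuclideanSpace.single i 1 :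
        EuclideanSpace ℂ κ)‖ ^ 2 + ‖x i‖ ^ 2 :=
      WithLp.prod_norm_sq_eq_of_L2 _
    refine le_of_sq_le_sq ?_ (by positivity)
    rw [h]
    split_ifs with hi
    · subst hi
      rw [norm_zero, mul_pow]
      nlinarith [sq_nonneg ‖x i‖, one_le_pow₀ he (n := 2)]
    · have := Real.add_one_le_exp (‖x i‖ ^ 2)
      simp
      nlinarith
  have hp : ∀ x : κ → H, ∏ i, ‖lift x i‖ ≤ ‖x a‖ * Real.exp (∑ i, ‖x i‖ ^ 2) := by
    intro x
    refine (Finset.prod_le_prod (fun _ _ => norm_nonneg _) fun i _ => hn x i).trans ?_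
    rw [Finset.prod_mul_distrib, Real.exp_sum, Finset.prod_ite_eq' Finset.univ a fun _ => ‖x a‖]
    simp
  have h4 : M.det - (1 + Matrix.of fun i j => ⟪Function.update x a 0 i, y j⟫_ℂ).det =
      (Matrix.of fun i j => ⟪lift x i, lift y j⟫_ℂ).det := by
    rw [← h2, ← h3]
    nth_rewrite 1 [h1]
    rw [Matrix.det_updateRow_add]
    ring
  rw [h4, Real.exp_add]
  refine (norm_det_inner_le _ _).trans ((mul_le_mul (hp x) (hp y)
    (Finset.prod_nonneg fun _ _ => norm_nonneg _) (by positivity)).trans_eq (by ring))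

section GramDet

theorem summable_norm_mul_norm {H ι : Type*} [SeminormedAddCommGroup H] {x y : ι →
    H} (hx : Summable fun i => ‖x i‖ ^ 2)
    (hy : Summable fun i => ‖y i‖ ^ 2) : Summable fun i => ‖x i‖ * ‖y i‖ :=
  Summable.of_nonneg_of_le (fun _ => by positivity)
    (fun i => by nlinarith [sq_nonneg (‖x i‖ - ‖y i‖), sq_nonneg ‖x i‖,
        sq_nonneg ‖y i‖]) (hx.add hy)

variable {H ι : Type*} [NormedAddCommGroup H] [InnerProductSpace ℂ H]

open Classical in
/-- The determinant of `1 + ∑ i ∈ s, ⟨x i, ·⟩ y i`, computed on the index side. -/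
def gramDet (x y : ι → H) (s : Finset ι) : ℂ :=
  (1 + Matrix.of fun i j : s => ⟪x i, y j⟫_ℂ).det

theorem norm_gramDet_insert_sub_le [DecidableEq ι] (x y : ι →
    H) {a : ι} {s : Finset ι} (ha : a ∉ s) :
    ‖gramDet x y (insert a s) - gramDet x y s‖ ≤ ‖x a‖ * ‖y a‖ *
      Real.exp (∑ i ∈ insert a s, ‖x i‖ ^ 2 + ∑ i ∈ insert a s, ‖y i‖ ^ 2) := by
  let t := insert a s
  let a' : t := ⟨a, Finset.mem_insert_self a s⟩
  have h := norm_det_one_add_inner_sub_le (fun i : t => x i) (fun i : t => y i) a'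
  rw [Finset.sum_coe_sort t fun i => ‖x i‖ ^ 2, Finset.sum_coe_sort t fun i => ‖y i‖ ^ 2] at h
  have h1 : (1 + (Matrix.of fun i j : t => ⟪x i, y j⟫_ℂ : Matrix t t ℂ)).det = gramDet x y t := by
    unfold gramDet
    congr!
  have h2 : (1 + (Matrix.of fun i j : t => ⟪Function.update (fun i : t => x i) a' 0 i,
      y j⟫_ℂ : Matrix t t ℂ)).det =
      gramDet x y s := by
    rw [Matrix.twoBlockTriangular_det _ (fun i : t => (i : ι) ∈ s)]
    · have : Matrix.toSquareBlockProp (1 + (Matrix.of fun i j : t =>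
          ⟪Function.update (fun i : t => x i) a' 0 i, y j⟫_ℂ : Matrix t t ℂ)) (fun i : t => ¬ (i :
              ι) ∈ s) = 1 := by
        ext ⟨i, hi⟩ ⟨j, hj⟩
        have hia : i = a' := by
          ext
          exact (Finset.mem_insert.1 i.2).resolve_right hi
        subst hia
        simp [Matrix.toSquareBlockProp, Matrix.one_apply]
      rw [this, Matrix.det_one, mul_one, gramDet]
      let e : s ≃ {i : t // (i : ι) ∈ s} :=
        { toFun := fun i => ⟨⟨i, Finset.mem_insert_of_mem i.2⟩, i.2⟩
          invFun := fun i => ⟨i.1, i.2⟩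
          left_inv := fun _ => rfl
          right_inv := fun _ => rfl }
      rw [← Matrix.det_submatrix_equiv_self e]
      congr!
      ext i j
      have hi : (e i).1 ≠ a' := fun h => ha (by
        have : (i : ι) = a := congrArg Subtype.val h
        exact this ▸ i.2)
      simp [Matrix.toSquareBlockProp, Matrix.one_apply, Function.update_of_ne hi]
      simp [e]
    · intro i hi j hj
      have hia : i = a' := by
        ext
        exact (Finset.mem_insert.1 i.2).resolve_right hi
      have hij : i ≠ j := fun h => hi (h ▸ hj)
      rw [Matrix.add_apply, Matrix.one_apply_ne hij]
      subst hia
      simp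
  rwa [h1, h2] at h

theorem norm_gramDet_sub_le [DecidableEq ι] {x y : ι → H} {C : ℝ}
    (hC : ∀ u : Finset ι, ∑ i ∈ u, ‖x i‖ ^ 2 + ∑ i ∈ u, ‖y i‖ ^ 2 ≤
        C) {s t : Finset ι} (hst : s ⊆ t) :
    ‖gramDet x y t - gramDet x y s‖ ≤ Real.exp C * ∑ i ∈ t \ s, ‖x i‖ * ‖y i‖ := by
  suffices h : ∀ u : Finset ι, Disjoint s u →
      ‖gramDet x y (u ∪ s) - gramDet x y s‖ ≤ Real.exp C * ∑ i ∈ u, ‖x i‖ * ‖y i‖ by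
    have := h (t \ s) Finset.disjoint_sdiff
    rwa [Finset.sdiff_union_of_subset hst] at this
  intro u
  induction u using Finset.induction_on with
  | empty => simp
  | insert a u ha ih =>
    intro hd
    rw [Finset.disjoint_insert_right] at hd
    have h1 := ih hd.2
    have h2 := norm_gramDet_insert_sub_le x y (a := a) (s := u ∪ s) (by simp [ha, hd.1])
    rw [Finset.sum_insert ha, Finset.insert_union, mul_add]
    refine (norm_sub_le_norm_sub_add_norm_sub _ (gramDet x y (u ∪ s)) _).trans
      (add_le_add (h2.trans ?_) h1)
    rw [mul_comm]
    exact mul_le_mul_of_nonneg_right (Real.exp_le_exp.2 (hC _)) (by positivity)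

/-- A representation `K = ∑ i, ⟨x i, ·⟩ y i` with square summable families `x` and `y`. -/
structure IsTraceRep (x y : ι → H) (K : H →L[ℂ] H) : Prop where
  summable_left : Summable fun i => ‖x i‖ ^ 2
  summable_right : Summable fun i => ‖y i‖ ^ 2
  hasSum : HasSum (fun i => InnerProductSpace.rankOne ℂ (y i) (x i)) K

theorem isTraceClass_of_hasSum [Countable ι] {K : H →L[ℂ] H} {x y : ι → H}
    (h : Summable fun i => ‖x i‖ * ‖y i‖)
    (hK : HasSum (fun i => InnerProductSpace.rankOne ℂ (y i) (x i)) K) : IsTraceClass K := by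
  obtain ⟨f, hf⟩ := exists_injective_nat ι
  refine ⟨Function.extend f x 0, Function.extend f y 0, ?_, ?_⟩
  · have : (fun n => ‖Function.extend f x 0 n‖ * ‖Function.extend f y 0 n‖) =
        Function.extend f (fun i => ‖x i‖ * ‖y i‖) 0 := by
      ext n
      by_cases hn : ∃ i, f i = n
      · obtain ⟨i, rfl⟩ := hn
        simp [hf.extend_apply]
      · simp [Function.extend_apply' _ _ _ hn]
    rw [this]
    exact ((hasSum_extend_zero hf).2 h.hasSum).summable
  · have : (fun n => InnerProductSpace.rankOne ℂ (Function.extend f y 0 n)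
      (Function.extend f x 0 n)) =
        Function.extend f (fun i => InnerProductSpace.rankOne ℂ (y i) (x i)) 0 := by
      ext1 n
      by_cases hn : ∃ i, f i = n
      · obtain ⟨i, rfl⟩ := hn
        simp [hf.extend_apply]
      · simp [Function.extend_apply' _ _ _ hn]
    rw [this]
    exact (hasSum_extend_zero hf).2 hK

theorem IsTraceRep.isTraceClass [Countable ι] {K : H →L[ℂ] H} {x y : ι → H} (h : IsTraceRep x y K) :
    IsTraceClass K :=
  isTraceClass_of_hasSum (summable_norm_mul_norm h.summable_left h.summable_right) h.hasSum

theorem exists_balanced (x y : H) : ∃ x' y' : H, ‖x'‖ ^ 2 = ‖x‖ * ‖y‖ ∧ ‖y'‖ ^ 2 = ‖x‖ * ‖y‖ ∧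
    InnerProductSpace.rankOne ℂ y' x' = InnerProductSpace.rankOne ℂ y x := by
  by_cases h : x = 0 ∨ y = 0
  · refine ⟨0, 0, ?_, ?_, ?_⟩ <;> rcases h with rfl | rfl <;> simp
  · push Not at h
    have hx := norm_pos_iff.2 h.1
    have hy := norm_pos_iff.2 h.2
    set c : ℝ := Real.sqrt (‖y‖ / ‖x‖) with hc
    have hc0 : 0 < c := Real.sqrt_pos.2 (by positivity)
    have hc2 : c ^ 2 = ‖y‖ / ‖x‖ := Real.sq_sqrt (by positivity)
    have hcc : (c : ℂ) ≠ 0 := by exact_mod_cast hc0.ne'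
    refine ⟨(c : ℂ) • x, (c : ℂ)⁻¹ • y, ?_, ?_, ?_⟩
    · rw [norm_smul, Complex.norm_real, mul_pow, Real.norm_eq_abs, sq_abs, hc2]
      field_simp
    · rw [norm_smul, norm_inv, Complex.norm_real, mul_pow, Real.norm_eq_abs, inv_pow, sq_abs, hc2]
      field_simp
    · ext z
      rw [InnerProductSpace.rankOne_apply, InnerProductSpace.rankOne_apply, inner_smul_left,
        Complex.conj_ofReal, smul_smul, mul_right_comm, mul_inv_cancel₀ hcc, one_mul]

theorem BlockLaurent.IsTraceClass.exists_isTraceRep {K : H →L[ℂ] H} (h : IsTraceClass K) :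
    ∃ x y : ℕ → H, IsTraceRep x y K := by
  obtain ⟨x, y, hs, hK⟩ := h
  choose x' y' hx hy hxy using fun n => exists_balanced (x n) (y n)
  exact ⟨x', y', by simpa only [hx] using hs, by simpa only [hy] using hs,
      by simpa only [hxy] using hK⟩

theorem exists_tendsto_gramDet {x y : ι → H} (hx : Summable fun i => ‖x i‖ ^ 2)
    (hy : Summable fun i => ‖y i‖ ^ 2) : ∃ d, Tendsto (gramDet x y) atTop (𝓝 d) := by
  classical
  have hC : ∀ u : Finset ι, ∑ i ∈ u, ‖x i‖ ^ 2 + ∑ i ∈ u, ‖y i‖ ^ 2 ≤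
      ∑' i, ‖x i‖ ^ 2 + ∑' i, ‖y i‖ ^ 2 := fun u =>
    add_le_add (hx.sum_le_tsum _ fun _ _ => by positivity)
        (hy.sum_le_tsum _ fun _ _ => by positivity)
  set C := ∑' i, ‖x i‖ ^ 2 + ∑' i, ‖y i‖ ^ 2
  have hxy := summable_norm_mul_norm hx hy
  refine cauchySeq_tendsto_of_complete (cauchySeq_of_le_tendsto_0'
    (fun s => Real.exp C * (∑' i, ‖x i‖ * ‖y i‖ - ∑ i ∈ s, ‖x i‖ * ‖y i‖)) (fun s t hst => ?_) ?_)
  · rw [dist_comm, dist_eq_norm]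
    refine (norm_gramDet_sub_le hC hst).trans (mul_le_mul_of_nonneg_left ?_ (Real.exp_pos _).le)
    rw [le_sub_iff_add_le, Finset.sum_sdiff hst]
    exact hxy.sum_le_tsum _ fun _ _ => by positivity
  · simpa using (hxy.hasSum.const_sub (∑' i, ‖x i‖ * ‖y i‖)).const_mul (Real.exp C)

end GramDet

section Sections

variable {N : ℕ}

theorem inner_stdBasis (p : ℤ × Fin N) (x : Ell2 N) : ⟪stdBasis p, x⟫_ℂ = x p.1 p.2 := by
  rw [stdBasis, lp.inner_single_left, EuclideanSpace.inner_single_left]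
  simp

theorem stdBasis_apply (p q : ℤ × Fin N) :
    (stdBasis p : Ell2 N) q.1 q.2 = if q = p then 1 else 0 := by
  obtain ⟨j, i⟩ := p
  obtain ⟨l, m⟩ := q
  by_cases h : l = j
  · subst h
    simp [stdBasis]
  · simp [stdBasis, h]

theorem orthonormal_stdBasis : Orthonormal ℂ (stdBasis (N := N)) := by
  classical
  rw [orthonormal_iff_ite]
  intro p q
  rw [inner_stdBasis, stdBasis_apply]

theorem hasSum_stdBasis (x : Ell2 N) : HasSum (fun p => ⟪stdBasis p, x⟫_ℂ • stdBasis p) x := by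
  let b : HilbertBasis (ℤ × Fin N) ℂ (Ell2 N) :=
    HilbertBasis.mkOfOrthogonalEqBot orthonormal_stdBasis (by
      rw [Submodule.eq_bot_iff]
      intro v hv
      ext j i
      have := hv _ (Submodule.subset_span (Set.mem_range_self (j, i)))
      rwa [inner_stdBasis] at this)
  have h := b.hasSum_repr x
  simpa only [b, HilbertBasis.repr_apply_apply, HilbertBasis.coe_mkOfOrthogonalEqBot] using h

/-- The orthogonal projection onto the span of the basis vectors with index in `S`. -/
def sectionProj (S : Finset (ℤ × Fin N)) (x : Ell2 N) : Ell2 N :=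
  ∑ p ∈ S, ⟪stdBasis p, x⟫_ℂ • stdBasis p

theorem norm_sectionProj_le (S : Finset (ℤ × Fin N)) (x : Ell2 N) : ‖sectionProj S x‖ ≤ ‖x‖ := by
  refine le_of_sq_le_sq ?_ (norm_nonneg _)
  refine le_trans (le_of_eq ?_) (orthonormal_stdBasis.sum_inner_products_le x (s := S))
  rw [sectionProj, norm_sq_eq_re_inner (𝕜 := ℂ), orthonormal_stdBasis.inner_sum, map_sum]
  refine Finset.sum_congr rfl fun p _ => ?_
  rw [RCLike.conj_mul, ← RCLike.ofReal_pow, RCLike.ofReal_re]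

theorem tendsto_sectionProj (x : Ell2 N) :
    Tendsto (fun S => sectionProj S x) atTop (𝓝 x) := hasSum_stdBasis x

theorem det_finSection_sum_rankOne {ι : Type*} (x y : ι → Ell2 N) (s : Finset ι)
    (S : Finset (ℤ × Fin N)) :
    (finSection (1 + ∑ i ∈ s, InnerProductSpace.rankOne ℂ (y i) (x i)) S).det =
      gramDet x (fun i => sectionProj S (y i)) s := by
  classical
  let A : Matrix S s ℂ := Matrix.of fun p i => ⟪stdBasis p.1, y i⟫_ℂ
  let B : Matrix s S ℂ := Matrix.of fun i p => ⟪x i, stdBasis p.1⟫_ℂ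
  have h1 : finSection (1 + ∑ i ∈ s, InnerProductSpace.rankOne ℂ (y i) (x i)) S = 1 + A * B := by
    ext p q
    have h2 : ⟪stdBasis p.1, stdBasis q.1⟫_ℂ = (1 : Matrix S S ℂ) p q := by
      rw [orthonormal_iff_ite.1 orthonormal_stdBasis, Matrix.one_apply]
      exact if_congr Subtype.coe_inj rfl rfl
    have h3 : (A * B) p q = ∑ i ∈ s, ⟪stdBasis p.1, y i⟫_ℂ * ⟪x i, stdBasis q.1⟫_ℂ := by
      rw [Matrix.mul_apply, ← Finset.sum_coe_sort s]
      rfl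
    rw [Matrix.add_apply, h3, ← h2, finSection, Matrix.of_apply, add_apply, inner_add_right,
      one_apply_eq_self, sum_apply, inner_sum]
    congr 1
    refine Finset.sum_congr rfl fun i _ => ?_
    rw [InnerProductSpace.rankOne_apply, inner_smul_right, mul_comm]
  have h3 : B * A = Matrix.of fun i j : s => ⟪x i, sectionProj S (y j)⟫_ℂ := by
    ext i j
    simp only [Matrix.of_apply, Matrix.mul_apply, A, B, sectionProj, inner_sum, inner_smul_right]
    rw [Finset.sum_coe_sort S fun p => ⟪x i, stdBasis p⟫_ℂ * ⟪stdBasis p, y j⟫_ℂ]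
    simp only [mul_comm]
  rw [h1, gramDet, ← h3]
  convert Matrix.det_one_add_mul_comm A B

variable {ι : Type*} {x y : ι → Ell2 N} {K : Ell2 N →L[ℂ] Ell2 N}

theorem IsTraceRep.tendsto_det_finSection (h : IsTraceRep x y K) (S : Finset (ℤ × Fin N)) :
    Tendsto (gramDet x fun i => sectionProj S (y i)) atTop (𝓝 (finSection (1 + K) S).det) := by
  classical
  have hc : Continuous fun T : Ell2 N →L[ℂ] Ell2 N => (finSection (1 + T) S).det := by
    refine Continuous.matrix_det (continuous_matrix fun p q => ?_)
    simp only [finSection, Matrix.of_apply]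
    fun_prop
  have := (hc.tendsto K).comp h.hasSum
  refine this.congr fun s => ?_
  exact det_finSection_sum_rankOne x y s S

theorem tendsto_gramDet_sectionProj (x y : ι → Ell2 N) (s : Finset ι) :
    Tendsto (fun S => gramDet x (fun i => sectionProj S (y i)) s) atTop (𝓝 (gramDet x y s)) := by
  classical
  have hc : Continuous fun M : Matrix s s ℂ => (1 + M).det := by fun_prop
  refine (hc.tendsto _).comp (tendsto_pi_nhds.2 fun i => tendsto_pi_nhds.2 fun j => ?_)
  exact tendsto_const_nhds.inner (tendsto_sectionProj (y j))

theorem IsTraceRep.tendsto_finSection (h : IsTraceRep x y K) {d : ℂ}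
    (hd : Tendsto (gramDet x y) atTop (𝓝 d)) :
    Tendsto (fun S : Finset (ℤ × Fin N) => (finSection (1 + K) S).det) atTop (𝓝 d) := by
  classical
  have hx := h.summable_left
  have hy := h.summable_right
  have hxy := summable_norm_mul_norm hx hy
  set C := ∑' i, ‖x i‖ ^ 2 + ∑' i, ‖y i‖ ^ 2
  have hC : ∀ u : Finset ι, ∑ i ∈ u, ‖x i‖ ^ 2 + ∑ i ∈ u, ‖y i‖ ^ 2 ≤ C := fun u =>
    add_le_add (hx.sum_le_tsum _ fun _ _ => by positivity)
        (hy.sum_le_tsum _ fun _ _ => by positivity)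
  have hCS : ∀ (S : Finset (ℤ × Fin N)) (u : Finset ι),
      ∑ i ∈ u, ‖x i‖ ^ 2 + ∑ i ∈ u, ‖sectionProj S (y i)‖ ^ 2 ≤ C := fun S u =>
    (add_le_add le_rfl (Finset.sum_le_sum fun i _ =>
      pow_le_pow_left₀ (norm_nonneg _) (norm_sectionProj_le S (y i)) 2)).trans (hC u)
  have htail : ∀ (S : Finset (ℤ × Fin N)) (s : Finset ι),
      ‖(finSection (1 + K) S).det - gramDet x (fun i => sectionProj S (y i)) s‖ ≤
        Real.exp C * (∑' i, ‖x i‖ * ‖y i‖ - ∑ i ∈ s, ‖x i‖ * ‖y i‖) := by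
    intro S s
    refine le_of_tendsto ((h.tendsto_det_finSection S).sub_const _).norm ?_
    filter_upwards [eventually_ge_atTop s] with t hst
    refine (norm_gramDet_sub_le (hCS S) hst).trans
      (mul_le_mul_of_nonneg_left ?_ (Real.exp_pos _).le)
    rw [le_sub_iff_add_le]
    refine le_trans ?_ (hxy.sum_le_tsum t fun _ _ => by positivity)
    rw [← Finset.sum_sdiff hst]
    gcongr
    exact norm_sectionProj_le S _
  have hlim : Tendsto (fun s => Real.exp C * (∑' i, ‖x i‖ * ‖y i‖ - ∑ i ∈ s, ‖x i‖ * ‖y i‖))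
      atTop (𝓝 0) := by
    simpa using (hxy.hasSum.const_sub (∑' i, ‖x i‖ * ‖y i‖)).const_mul (Real.exp C)
  rw [Metric.tendsto_nhds]
  intro ε hε
  obtain ⟨s, hs1, hs2⟩ := ((hlim.eventually (gt_mem_nhds (show 0 < ε / 3 by positivity))).and
    (Metric.tendsto_nhds.1 hd (ε / 3) (by positivity))).exists
  filter_upwards [Metric.tendsto_nhds.1 (tendsto_gramDet_sectionProj x y s) (ε / 3) (by positivity)]
    with S hS
  have h1 := dist_triangle4 (finSection (1 + K) S).det (gramDet x (fun i => sectionProj S (y i)) s)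
    (gramDet x y s) d
  have h2 := htail S s
  rw [← dist_eq_norm] at h2
  linarith

theorem IsTraceRep.hasFredholmDet_iff [Countable ι] (h : IsTraceRep x y K) {d : ℂ} :
    HasFredholmDet (1 + K) d ↔ Tendsto (gramDet x y) atTop (𝓝 d) := by
  refine ⟨fun hd => ?_, fun hd => ⟨?_, h.tendsto_finSection hd⟩⟩
  · obtain ⟨d', hd'⟩ := exists_tendsto_gramDet h.summable_left h.summable_right
    rwa [tendsto_nhds_unique hd.2 (h.tendsto_finSection hd')]
  · rw [add_sub_cancel_left]
    exact h.isTraceClass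

theorem BlockLaurent.IsTraceClass.exists_hasFredholmDet (h : IsTraceClass K) :
    ∃ d, HasFredholmDet (1 + K) d := by
  obtain ⟨x, y, hxy⟩ := h.exists_isTraceRep
  obtain ⟨d, hd⟩ := exists_tendsto_gramDet hxy.summable_left hxy.summable_right
  exact ⟨d, hxy.hasFredholmDet_iff.2 hd⟩

theorem IsTraceRep.comp_left {H ι : Type*} [NormedAddCommGroup H] [InnerProductSpace ℂ H] {x y :
    ι → H}
    {K : H →L[ℂ] H} (h : IsTraceRep x y K) (X : H →L[ℂ] H) :
    IsTraceRep x (fun i => X (y i)) (X ∘L K) := by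
  refine ⟨h.summable_left, ?_, ?_⟩
  · refine Summable.of_nonneg_of_le (fun _ => by positivity) (fun i => ?_)
      (h.summable_right.mul_left (‖X‖ ^ 2))
    rw [← mul_pow]
    exact pow_le_pow_left₀ (norm_nonneg _) (X.le_opNorm _) 2
  · have := h.hasSum.mapL (ContinuousLinearMap.compL ℂ H H H X)
    simpa only [ContinuousLinearMap.compL_apply, InnerProductSpace.comp_rankOne] using this

theorem IsTraceRep.comp_right {H ι : Type*} [NormedAddCommGroup H] [InnerProductSpace ℂ H]
    [CompleteSpace H] {x y : ι → H} {K : H →L[ℂ] H} (h : IsTraceRep x y K) (X : H →L[ℂ] H) :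
    IsTraceRep (fun i => ContinuousLinearMap.adjoint X (x i)) y (K ∘L X) := by
  refine ⟨?_, h.summable_right, ?_⟩
  · refine Summable.of_nonneg_of_le (fun _ => by positivity) (fun i => ?_)
      (h.summable_left.mul_left (‖ContinuousLinearMap.adjoint X‖ ^ 2))
    rw [← mul_pow]
    exact pow_le_pow_left₀ (norm_nonneg _) (ContinuousLinearMap.le_opNorm _ _) 2
  · have := h.hasSum.mapL ((ContinuousLinearMap.compL ℂ H H H).flip X)
    simpa only [ContinuousLinearMap.compL_apply, InnerProductSpace.rankOne_comp,
        ContinuousLinearMap.flip_apply] using this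

/-- `det (1 + X K) = det (1 + K X)` for `K` of trace class and `X` bounded. -/
theorem hasFredholmDet_mul_comm (hK : IsTraceClass K) (X : Ell2 N →L[ℂ] Ell2 N) {d : ℂ} :
    HasFredholmDet (1 + X ∘L K) d ↔ HasFredholmDet (1 + K ∘L X) d := by
  obtain ⟨x, y, hxy⟩ := hK.exists_isTraceRep
  rw [(hxy.comp_left X).hasFredholmDet_iff, (hxy.comp_right X).hasFredholmDet_iff]
  have : gramDet x (fun i => X (y i)) = gramDet (fun i => ContinuousLinearMap.adjoint X
      (x i)) y := by
    ext s
    simp only [gramDet, ContinuousLinearMap.adjoint_inner_left]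
  rw [this]

end Sections

section TraceClass

variable {H : Type*} [NormedAddCommGroup H] [InnerProductSpace ℂ H] {K K' : H →L[ℂ] H}

theorem BlockLaurent.IsTraceClass.comp_left (h : IsTraceClass K) (X : H →L[ℂ] H) :
    IsTraceClass (X ∘L K) := by
  obtain ⟨x, y, hxy⟩ := h.exists_isTraceRep
  exact (hxy.comp_left X).isTraceClass

theorem BlockLaurent.IsTraceClass.comp_right [CompleteSpace H] (h : IsTraceClass K) (X :
    H →L[ℂ] H) :
    IsTraceClass (K ∘L X) := by
  obtain ⟨x, y, hxy⟩ := h.exists_isTraceRep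
  exact (hxy.comp_right X).isTraceClass

theorem IsTraceRep.sumElim {ι κ : Type*} {x y : ι → H} {u v : κ → H} (h : IsTraceRep x y K)
    (h' : IsTraceRep u v K') : IsTraceRep (Sum.elim x u) (Sum.elim y v) (K + K') :=
  ⟨(HasSum.sum (f := fun i => ‖Sum.elim x u i‖ ^ 2) h.summable_left.hasSum
      h'.summable_left.hasSum).summable,
   (HasSum.sum (f := fun i => ‖Sum.elim y v i‖ ^ 2) h.summable_right.hasSum
       h'.summable_right.hasSum).summable,
   HasSum.sum (f := fun i => InnerProductSpace.rankOne ℂ (Sum.elim y v i)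
       (Sum.elim x u i)) h.hasSum h'.hasSum⟩

theorem BlockLaurent.IsTraceClass.add (h : IsTraceClass K) (h' : IsTraceClass K') :
    IsTraceClass (K + K') := by
  obtain ⟨x, y, hxy⟩ := h.exists_isTraceRep
  obtain ⟨u, v, huv⟩ := h'.exists_isTraceRep
  exact (hxy.sumElim huv).isTraceClass

theorem BlockLaurent.IsTraceClass.smul (h : IsTraceClass K) (c : ℂ) : IsTraceClass (c • K) := by
  simpa using h.comp_left (c • ContinuousLinearMap.id ℂ H)

theorem BlockLaurent.IsTraceClass.neg (h : IsTraceClass K) : IsTraceClass (-K) := by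
  simpa using h.smul (-1)

theorem BlockLaurent.IsTraceClass.sub (h : IsTraceClass K) (h' : IsTraceClass K') :
    IsTraceClass (K - K') := by
  rw [sub_eq_add_neg]
  exact h.add h'.neg

theorem isTraceRep_of_fintype {ι : Type*} [Fintype ι] (x y : ι → H) :
    IsTraceRep x y (∑ i, InnerProductSpace.rankOne ℂ (y i) (x i)) :=
  ⟨(hasSum_fintype _).summable, (hasSum_fintype _).summable, hasSum_fintype _⟩

end TraceClass

section Mul

variable {N : ℕ}

theorem tendsto_of_hasFredholmDet_truncation {κ : Type*} {u v : κ → Ell2 N}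
    {B K : Ell2 N →L[ℂ] Ell2 N} (hB : IsTraceClass B) (hK : IsTraceRep u v K) {d : ℂ}
    {g : Finset κ → ℂ} (hd : HasFredholmDet (1 + (B + K)) d)
    (hg : ∀ t, HasFredholmDet (1 + (B + ∑ i ∈ t, InnerProductSpace.rankOne ℂ (v i) (u i))) (g t)) :
    Tendsto g atTop (𝓝 d) := by
  classical
  obtain ⟨x, y, hxy⟩ := hB.exists_isTraceRep
  have h := hxy.sumElim hK
  have huv := summable_norm_mul_norm hK.summable_left hK.summable_right
  set C := ∑' i, ‖Sum.elim x u i‖ ^ 2 + ∑' i, ‖Sum.elim y v i‖ ^ 2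
  have hCS : ∀ (S : Finset (ℤ × Fin N)) (w : Finset (ℕ ⊕ κ)), ∑ i ∈ w, ‖Sum.elim x u i‖ ^ 2 +
      ∑ i ∈ w, ‖sectionProj S (Sum.elim y v i)‖ ^ 2 ≤ C := fun S w =>
    (add_le_add le_rfl (Finset.sum_le_sum fun i _ =>
      pow_le_pow_left₀ (norm_nonneg _) (norm_sectionProj_le S _) 2)).trans
      (add_le_add (h.summable_left.sum_le_tsum _ fun _ _ => by positivity)
        (h.summable_right.sum_le_tsum _ fun _ _ => by positivity))
  have hc : ∀ S : Finset (ℤ × Fin N), Continuous fun T : Ell2 N →L[ℂ] Ell2 N =>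
      (finSection (1 + T) S).det := fun S => by
    refine Continuous.matrix_det (continuous_matrix fun p q => ?_)
    simp only [finSection, Matrix.of_apply]
    fun_prop
  have h1 : ∀ (S : Finset (ℤ × Fin N)) (t : Finset κ), Tendsto (fun s : Finset ℕ =>
      gramDet (Sum.elim x u) (fun i => sectionProj S (Sum.elim y v i)) (s.disjSum t)) atTop
      (𝓝 (finSection (1 + (B + ∑ i ∈ t, InnerProductSpace.rankOne ℂ (v i) (u i))) S).det) := by
    intro S t
    refine (((hc S).tendsto _).comp (hxy.hasSum.add_const
      (∑ i ∈ t, InnerProductSpace.rankOne ℂ (v i) (u i)))).congr fun s => ?_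
    rw [← det_finSection_sum_rankOne, Finset.sum_disjSum]
    rfl
  have h2 : ∀ (S : Finset (ℤ × Fin N)) (t t' : Finset κ), t ⊆ t' →
      ‖(finSection (1 + (B + ∑ i ∈ t', InnerProductSpace.rankOne ℂ (v i) (u i))) S).det -
        (finSection (1 + (B + ∑ i ∈ t, InnerProductSpace.rankOne ℂ (v i) (u i))) S).det‖ ≤
      Real.exp C * (∑' i, ‖u i‖ * ‖v i‖ - ∑ i ∈ t, ‖u i‖ * ‖v i‖) := by
    intro S t t' htt'
    refine le_of_tendsto ((h1 S t').sub (h1 S t)).norm (Eventually.of_forall fun s => ?_)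
    have hsub : s.disjSum t ⊆ s.disjSum t' := Finset.disjSum_mono le_rfl htt'
    refine (norm_gramDet_sub_le (hCS S) hsub).trans
      (mul_le_mul_of_nonneg_left ?_ (Real.exp_pos _).le)
    rw [le_sub_iff_add_le]
    refine le_trans ?_ (huv.sum_le_tsum t' fun _ _ => by positivity)
    have h3 := Finset.sum_sdiff (f := fun i => ‖Sum.elim x u i‖ * ‖Sum.elim y v i‖) hsub
    simp only [Finset.sum_disjSum, Sum.elim_inl, Sum.elim_inr] at h3
    have h4 : ∑ i ∈ s.disjSum t' \ s.disjSum t, ‖Sum.elim x u i‖ * ‖sectionProj S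
        (Sum.elim y v i)‖ ≤
        ∑ i ∈ s.disjSum t' \ s.disjSum t, ‖Sum.elim x u i‖ * ‖Sum.elim y v i‖ := by
      gcongr
      exact norm_sectionProj_le S _
    linarith
  have h3 : ∀ t t' : Finset κ, t ⊆ t' → ‖g t' - g t‖ ≤
      Real.exp C * (∑' i, ‖u i‖ * ‖v i‖ - ∑ i ∈ t, ‖u i‖ * ‖v i‖) := fun t t' htt' =>
    le_of_tendsto ((hg t').2.sub (hg t).2).norm (Eventually.of_forall fun S => h2 S t t' htt')
  have h4 : ∀ (S : Finset (ℤ × Fin N)) (t : Finset κ), ‖(finSection (1 + (B + K)) S).det -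
      (finSection (1 + (B + ∑ i ∈ t, InnerProductSpace.rankOne ℂ (v i) (u i))) S).det‖ ≤
      Real.exp C * (∑' i, ‖u i‖ * ‖v i‖ - ∑ i ∈ t, ‖u i‖ * ‖v i‖) := fun S t =>
    le_of_tendsto ((((hc S).tendsto _).comp (hK.hasSum.const_add B)).sub_const _).norm
      ((eventually_ge_atTop t).mono fun t' ht' => h2 S t t' ht')
  have h5 : ∀ t : Finset κ, ‖d - g t‖ ≤
      Real.exp C * (∑' i, ‖u i‖ * ‖v i‖ - ∑ i ∈ t, ‖u i‖ * ‖v i‖) := fun t =>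
    le_of_tendsto (hd.2.sub (hg t).2).norm (Eventually.of_forall fun S => h4 S t)
  rw [tendsto_iff_norm_sub_tendsto_zero]
  refine squeeze_zero (fun _ => norm_nonneg _) (fun t => (norm_sub_rev _ _).trans_le (h5 t)) ?_
  simpa using (huv.hasSum.const_sub (∑' i, ‖u i‖ * ‖v i‖)).const_mul (Real.exp C)

theorem gramDet_disjSum_univ {H ι τ : Type*} [NormedAddCommGroup H] [InnerProductSpace ℂ H]
    [Fintype τ] (x x' y : ι → H) (u v : τ → H)
    (hx' : ∀ i z, ⟪x' i, z⟫_ℂ = ⟪x i, z⟫_ℂ + ∑ j, ⟪x i, v j⟫_ℂ * ⟪u j, z⟫_ℂ) (s : Finset ι) :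
    gramDet (Sum.elim x' u) (Sum.elim y v) (s.disjSum Finset.univ) =
      gramDet x y s * (gramDet u v Finset.univ) := by
  classical
  let e : s ⊕ (Finset.univ : Finset τ) ≃ (s.disjSum (Finset.univ : Finset τ)) :=
    { toFun := Sum.elim (fun i => ⟨Sum.inl i, by simp⟩) (fun i => ⟨Sum.inr i, by simp⟩)
      invFun := fun i => match i with
        | ⟨Sum.inl i, hi⟩ => Sum.inl ⟨i, by simpa using hi⟩
        | ⟨Sum.inr i, hi⟩ => Sum.inr ⟨i, by simp⟩
      left_inv := by rintro (i | i) <;> rfl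
      right_inv := by rintro ⟨i | i, hi⟩ <;> rfl }
  let G : Matrix s s ℂ := Matrix.of fun i j => ⟪x i, y j⟫_ℂ
  let W : Matrix s (Finset.univ : Finset τ) ℂ := Matrix.of fun i j => ⟪x i, v j⟫_ℂ
  let C : Matrix (Finset.univ : Finset τ) s ℂ := Matrix.of fun i j => ⟪u i, y j⟫_ℂ
  let D : Matrix (Finset.univ : Finset τ) (Finset.univ : Finset τ) ℂ := Matrix.of fun i j => ⟪u i,
      v j⟫_ℂ
  have key : (1 + Matrix.of fun i j : (s.disjSum (Finset.univ : Finset τ)) =>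
      ⟪Sum.elim x' u i, Sum.elim y v j⟫_ℂ).submatrix e e =
      Matrix.fromBlocks 1 W 0 1 * Matrix.fromBlocks (1 + G) 0 C (1 + D) := by
    rw [Matrix.fromBlocks_multiply]
    ext (i | i) (j | ⟨j, hj⟩)
    · simp [e, Matrix.one_apply, Matrix.mul_apply, hx', G, W, C, add_assoc]
    · simp [e, Matrix.one_apply, Matrix.mul_apply, hx', W, D, mul_add, Finset.sum_add_distrib]
    · simp [e, C]
    · obtain ⟨i, hi⟩ := i
      simp [e, Matrix.one_apply, D]
  have h1 : gramDet (Sum.elim x' u) (Sum.elim y v) (s.disjSum Finset.univ) =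
      (1 + Matrix.of fun i j : (s.disjSum (Finset.univ : Finset τ)) =>
      (⟪Sum.elim x' u i, Sum.elim y v j⟫_ℂ)).det := by
    unfold gramDet
    congr!
  rw [h1, ← Matrix.det_submatrix_equiv_self e, key, Matrix.det_mul, Matrix.det_fromBlocks_zero₂₁,
    Matrix.det_fromBlocks_zero₁₂, Matrix.det_one, Matrix.det_one, one_mul, one_mul]
  unfold gramDet
  congr!

theorem hasFredholmDet_comp_finite {τ : Type*} [Fintype τ] (u v : τ → Ell2 N)
    {K : Ell2 N →L[ℂ] Ell2 N} {d : ℂ} (h : HasFredholmDet (1 + K) d) :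
    HasFredholmDet ((1 + K) ∘L (1 + ∑ i, InnerProductSpace.rankOne ℂ (v i) (u i)))
      (d * gramDet u v Finset.univ) := by
  have hK : IsTraceClass K := by simpa using h.1
  obtain ⟨x, y, hxy⟩ := hK.exists_isTraceRep
  set F := ∑ i, InnerProductSpace.rankOne ℂ (v i) (u i)
  have hrep := (hxy.comp_right (1 + F)).sumElim (isTraceRep_of_fintype u v)
  have hop : (1 + K) ∘L (1 + F) = 1 + (K ∘L (1 + F) + F) := by
    change (1 + K) * (1 + F) = 1 + (K * (1 + F) + F)
    noncomm_ring
  rw [hop, hrep.hasFredholmDet_iff]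
  obtain ⟨d', hd'⟩ := exists_tendsto_gramDet hrep.summable_left hrep.summable_right
  have ht : Tendsto (fun s : Finset ℕ => s.disjSum (Finset.univ : Finset τ)) atTop atTop := by
    refine tendsto_atTop.2 fun w => ?_
    filter_upwards [eventually_ge_atTop w.toLeft] with s hs
    rw [← Finset.toLeft_disjSum_toRight (u := w)]
    exact Finset.disjSum_mono hs (Finset.subset_univ _)
  have h1 := hd'.comp ht
  have h2 : Tendsto (fun s => gramDet x y s * gramDet u v Finset.univ) atTop
      (𝓝 (d * gramDet u v Finset.univ)) := ((hxy.hasFredholmDet_iff).1 h).mul_const _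
  have h3 := h2.congr fun s => (gramDet_disjSum_univ x
    (fun i => ContinuousLinearMap.adjoint (1 + F) (x i)) y u v (fun i z => by
    rw [ContinuousLinearMap.adjoint_inner_left]
    simp [F, inner_add_right, inner_sum, inner_smul_right, mul_comm]) s).symm
  rwa [tendsto_nhds_unique h3 h1]

/-- Multiplicativity of the Fredholm determinant. -/
theorem BlockLaurent.HasFredholmDet.comp {T T' : Ell2 N →L[ℂ] Ell2 N} {d d' : ℂ}
    (h : HasFredholmDet T d) (h' : HasFredholmDet T' d') : HasFredholmDet (T ∘L T') (d * d') := by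
  obtain ⟨K, rfl⟩ : ∃ K, T = 1 + K := ⟨T - 1, by simp⟩
  obtain ⟨K', rfl⟩ : ∃ K, T' = 1 + K := ⟨T' - 1, by simp⟩
  have hK : IsTraceClass K := by simpa using h.1
  have hK' : IsTraceClass K' := by simpa using h'.1
  obtain ⟨u, v, huv⟩ := hK'.exists_isTraceRep
  have hop : ∀ F : Ell2 N →L[ℂ] Ell2 N, (1 + K) ∘L (1 + F) = 1 + (K + (1 + K) ∘L F) := fun F => by
    change (1 + K) * (1 + F) = 1 + (K + (1 + K) * F)
    noncomm_ring
  obtain ⟨d'', hd''⟩ := (hK.add (hK'.comp_left (1 + K))).exists_hasFredholmDet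
  let g : Finset ℕ → ℂ := fun t => gramDet (fun i : t => u i) (fun i : t => v i) Finset.univ
  have hsum : ∀ t : Finset ℕ, ∑ i : t, InnerProductSpace.rankOne ℂ (v i) (u i) =
      ∑ i ∈ t, InnerProductSpace.rankOne ℂ (v i) (u i) := fun t =>
    Finset.sum_coe_sort t fun i => InnerProductSpace.rankOne ℂ (v i) (u i)
  have hg : Tendsto g atTop (𝓝 d') := by
    have h0 : IsTraceClass (0 : Ell2 N →L[ℂ] Ell2 N) := by simpa using hK.smul 0
    refine tendsto_of_hasFredholmDet_truncation h0 huv (by rwa [zero_add]) fun t => ?_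
    rw [zero_add, ← hsum]
    refine (isTraceRep_of_fintype (fun i : t => u i) (fun i : t => v i)).hasFredholmDet_iff.2 ?_
    refine tendsto_const_nhds.congr' ?_
    filter_upwards [eventually_ge_atTop Finset.univ] with s hs
    rw [Finset.univ_subset_iff.1 hs]
  have hg' : Tendsto (fun t => d * g t) atTop (𝓝 d'') := by
    refine tendsto_of_hasFredholmDet_truncation hK (huv.comp_left (1 + K)) hd'' fun t => ?_
    have h1 := hasFredholmDet_comp_finite (fun i : t => u i) (fun i : t => v i) h
    rw [hsum, hop] at h1
    have h2 : ∑ i ∈ t, InnerProductSpace.rankOne ℂ ((1 + K) (v i)) (u i) =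
        (1 + K) ∘L ∑ i ∈ t, InnerProductSpace.rankOne ℂ (v i) (u i) := by
      rw [ContinuousLinearMap.comp_finsetSum]
      simp only [InnerProductSpace.comp_rankOne]
    rwa [h2]
  rw [hop, tendsto_nhds_unique (hg.const_mul d) hg']
  exact hd''

end Mul

section Fourier

open AddCircle

theorem hasSum_fourierCoeff_mul {f g : UnitAddCircle → ℂ} (hf : MemLp f 2 haarAddCircle)
    (hg : MemLp g 2 haarAddCircle) (n : ℤ) :
    HasSum (fun m => fourierCoeff f (n - m) * fourierCoeff g m)
      (fourierCoeff (fun t => f t * g t) n) := by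
  have hF : MemLp (fun t : UnitAddCircle => star (f t) * fourier n t) 2 haarAddCircle := by
    refine MemLp.of_le hf ?_ (Eventually.of_forall fun t => ?_)
    · exact hf.1.star.mul (fourier n).continuous.aestronglyMeasurable
    · rw [norm_mul, norm_star, fourier_apply, Circle.norm_coe, mul_one]
  have h := fourierBasis.hasSum_inner_mul_inner (hF.toLp _) (hg.toLp _)
  have h1 : ⟪hF.toLp _, hg.toLp _⟫_ℂ = fourierCoeff (fun t => f t * g t) n := by
    rw [L2.inner_def, fourierCoeff]
    refine integral_congr_ae ?_
    filter_upwards [hF.coeFn_toLp, hg.coeFn_toLp] with t h1 h2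
    rw [h1, h2, RCLike.inner_apply]
    simp only [map_mul, RCLike.star_def, Complex.conj_conj, smul_eq_mul, fourier_neg]
    ring
  have h2 : ∀ m, ⟪(fourierBasis m : Lp ℂ 2 (haarAddCircle (T := (1 : ℝ)))),
      hg.toLp _⟫_ℂ = fourierCoeff g m := fun m => by
    rw [← HilbertBasis.repr_apply_apply, fourierBasis_repr]
    exact congrFun (fourierCoeff_congr_ae hg.coeFn_toLp) m
  have h3 : ∀ m, ⟪hF.toLp _, (fourierBasis m : Lp ℂ 2 (haarAddCircle (T := (1 : ℝ))))⟫_ℂ =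
      fourierCoeff f (n - m) := fun m => by
    rw [L2.inner_def, fourierCoeff, coe_fourierBasis]
    refine integral_congr_ae ?_
    filter_upwards [hF.coeFn_toLp, coeFn_fourierLp 2 m] with t h1 h2
    rw [h1, h2, RCLike.inner_apply]
    have : -(n - m) = m + -n := by ring
    rw [this, fourier_add]
    simp only [map_mul, RCLike.star_def, Complex.conj_conj, smul_eq_mul, fourier_neg]
    ring
  simpa only [h1, h2, h3] using h

end Fourier

section Laurent

variable {N : ℕ}

theorem coeff_congr_ae {a b : MatFun N} (h : a =ᵐ[AddCircle.haarAddCircle] b) (n : ℤ) : coeff a n =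
    coeff b n := by
  ext i j
  have : (fun t => a t i j) =ᵐ[AddCircle.haarAddCircle] fun t => b t i j :=
    h.mono fun t ht => by simp only [ht]
  exact congrFun (fourierCoeff_congr_ae this) n

theorem hasSum_coeff_mul {a b : MatFun N} (ha : a ∈ LInf N) (hb : b ∈ LInf N) (n : ℤ) :
    HasSum (fun m => coeff a (n - m) * coeff b m) (coeff (a * b) n) := by
  have ha' : ∀ i j, MemLp (fun t => a t i j) 2 (AddCircle.haarAddCircle (T := (1 :
      ℝ))) := fun i j =>
    (ha i j).mono_exponent le_top
  have hb' : ∀ i j, MemLp (fun t => b t i j) 2 (AddCircle.haarAddCircle (T := (1 :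
      ℝ))) := fun i j =>
    (hb i j).mono_exponent le_top
  suffices h : ∀ i j, HasSum (fun m => (coeff a (n - m) * coeff b m) i j) (coeff (a * b) n i j) from
    Pi.hasSum.2 fun i => Pi.hasSum.2 fun j => h i j
  intro i j
  have h1 : coeff (a * b) n i j = ∑ l, fourierCoeff (fun t => a t i l * b t l j) n := by
    rw [← Finset.sum_apply, ← fourierCoeff.sum]
    · simp only [coeff, Matrix.of_apply, Pi.mul_apply, Matrix.mul_apply]
      congr 1
      ext t
      simp
    · exact fun l _ => (ha' i l).integrable_mul (hb' l j)
  rw [h1]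
  simpa only [Matrix.mul_apply, coeff, Matrix.of_apply] using
    hasSum_sum fun l (_ : l ∈ Finset.univ) => hasSum_fourierCoeff_mul (ha' i l) (hb' l j) n

theorem coeff_one (n : ℤ) : coeff (1 : MatFun N) n = if n = 0 then 1 else 0 := by
  have h1 : fourierCoeff (fun _ : UnitAddCircle => (1 : ℂ)) = Pi.single 0 1 := by
    rw [← fourierCoeff_fourier (T := 1) 0]
    congr 1
    ext t
    simp
  have h0 : fourierCoeff (fun _ : UnitAddCircle => (0 : ℂ)) n = 0 := by simp [fourierCoeff]
  ext i j
  simp only [coeff, Matrix.of_apply, Pi.one_apply, Matrix.one_apply]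
  by_cases hij : i = j
  · simp only [hij, if_true, h1]
    by_cases hn : n = 0 <;> simp [hn]
  · simp only [hij, if_false, h0]
    by_cases hn : n = 0 <;> simp [hn, hij]

theorem isLaurent_one : IsLaurent (1 : MatFun N) 1 := by
  intro k v j
  rw [coeff_one, one_apply_eq_self]
  by_cases h : j = k
  · subst h; simp
  · rw [lp.single_apply_ne _ _ _ h, if_neg (sub_ne_zero.2 h)]; simp

theorem BlockLaurent.IsLaurent.congr {a b : MatFun N} {A : Ell2 N →L[ℂ] Ell2 N} (hA : IsLaurent a A)
    (h : a =ᵐ[AddCircle.haarAddCircle] b) : IsLaurent b A := fun k v j => by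
  rw [hA k v j, coeff_congr_ae h]

theorem BlockLaurent.IsLaurent.mul {a b : MatFun N} {A B : Ell2 N →L[ℂ] Ell2 N} (hA : IsLaurent a A)
    (hB : IsLaurent b B) (ha : a ∈ LInf N) (hb : b ∈ LInf N) : IsLaurent (a * b) (A ∘L B) := by
  intro k v j
  have h1 := ((lp.hasSum_single (by norm_num) (B (lp.single 2 k v))).mapL A).mapL
    (lp.evalCLM ℂ (fun _ : ℤ => EuclideanSpace ℂ (Fin N)) 2 j)
  let ℓ : Matrix (Fin N) (Fin N) ℂ →ₗ[ℂ] EuclideanSpace ℂ (Fin N) :=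
    { toFun := fun M => Matrix.toEuclideanCLM (n := Fin N) (𝕜 := ℂ) M v
      map_add' := fun M M' => by simp
      map_smul' := fun c M => by simp }
  have h2 := (hasSum_coeff_mul ha hb (j - k)).map ℓ.toAddMonoidHom
    (LinearMap.continuous_of_finiteDimensional ℓ)
  have h3 := (Equiv.subRight k).hasSum_iff.2 h2
  refine HasSum.unique ?_ h3
  refine h1.congr_fun fun m => ?_
  change Matrix.toEuclideanCLM (n := Fin N) (𝕜 := ℂ) (coeff a (j - k - (m - k)) * coeff b
      (m - k)) v =
    (A (lp.single 2 m (B (lp.single 2 k v) m))) j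
  rw [hA, hB, map_mul]
  simp

theorem inner_laurent_stdBasis {a : MatFun N} {A : Ell2 N →L[ℂ] Ell2 N} (hA : IsLaurent a A)
    (p q : ℤ × Fin N) : ⟪stdBasis p, A (stdBasis q)⟫_ℂ = coeff a (p.1 - q.1) p.2 q.2 := by
  rw [inner_stdBasis, stdBasis, hA, Matrix.ofLp_toEuclideanCLM]
  simp [Matrix.mulVec_single]

theorem ext_stdBasis {T T' : Ell2 N →L[ℂ] Ell2 N}
    (h : ∀ p q, ⟪stdBasis p, T (stdBasis q)⟫_ℂ = ⟪stdBasis p, T' (stdBasis q)⟫_ℂ) : T = T' := by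
  have h1 : ∀ q : ℤ × Fin N, T (stdBasis q) = T' (stdBasis q) := fun q => by
    ext j i
    simpa only [inner_stdBasis] using h (j, i) q
  ext1 x
  refine ((hasSum_stdBasis x).mapL T).unique ?_
  simpa only [map_smul, h1] using (hasSum_stdBasis x).mapL T'

open Classical in
theorem inner_stdBasis_coordProj (S : Set ℤ) (p : ℤ × Fin N) (x : Ell2 N) :
    ⟪stdBasis p, coordProj S x⟫_ℂ = if p.1 ∈ S then ⟪stdBasis p, x⟫_ℂ else 0 := by
  rw [inner_stdBasis, inner_stdBasis, coordProj_apply]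
  split_ifs <;> simp

open Classical in
theorem coordProj_stdBasis (S : Set ℤ) (p : ℤ × Fin N) :
    coordProj S (stdBasis p) = if p.1 ∈ S then stdBasis p else 0 := by
  ext j i
  rw [← inner_stdBasis (j, i), ← inner_stdBasis (j, i), inner_stdBasis_coordProj, inner_stdBasis]
  rw [apply_ite (fun x : Ell2 N => ⟪stdBasis (j, i), x⟫_ℂ), inner_zero_right, inner_stdBasis,
    stdBasis_apply p (j, i)]
  by_cases h : (j, i) = p
  · subst h; simp
  · simp [h]

open Classical in
theorem inner_coordProj_comp (S S' : Set ℤ) (T : Ell2 N →L[ℂ] Ell2 N) (p q : ℤ × Fin N) :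
    ⟪stdBasis p, (coordProj S ∘L T ∘L coordProj S') (stdBasis q)⟫_ℂ =
      if p.1 ∈ S ∧ q.1 ∈ S' then ⟪stdBasis p, T (stdBasis q)⟫_ℂ else 0 := by
  simp only [ContinuousLinearMap.comp_apply, inner_stdBasis_coordProj, coordProj_stdBasis]
  split_ifs <;> simp_all

theorem isTraceClass_of_summable_entries {T : Ell2 N →L[ℂ] Ell2 N}
    (h : Summable fun r : (ℤ × Fin N) × (ℤ × Fin N) => ‖⟪stdBasis r.1, T (stdBasis r.2)⟫_ℂ‖) :
    IsTraceClass T := by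
  let y : (ℤ × Fin N) × (ℤ × Fin N) → Ell2 N := fun r => ⟪stdBasis r.1,
      T (stdBasis r.2)⟫_ℂ • stdBasis r.1
  let x : (ℤ × Fin N) × (ℤ × Fin N) → Ell2 N := fun r => stdBasis r.2
  have hxy : Summable fun r => ‖x r‖ * ‖y r‖ := by
    simpa only [x, y, norm_smul, orthonormal_stdBasis.1, one_mul, mul_one] using h
  have hs : Summable fun r => InnerProductSpace.rankOne ℂ (y r) (x r) :=
    Summable.of_norm_bounded hxy fun r => by rw [InnerProductSpace.norm_rankOne, mul_comm]
  suffices hT : ∑' r, InnerProductSpace.rankOne ℂ (y r) (x r) = T from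
    isTraceClass_of_hasSum hxy (hT ▸ hs.hasSum)
  refine ext_stdBasis fun p q => ?_
  have h1 := (hs.hasSum.mapL (ContinuousLinearMap.apply ℂ (Ell2 N) (stdBasis q))).mapL
    (innerSL ℂ (stdBasis p))
  refine h1.unique ?_
  have h2 : ∀ r, innerSL ℂ (stdBasis p) (ContinuousLinearMap.apply ℂ (Ell2 N) (stdBasis q)
      (InnerProductSpace.rankOne ℂ (y r) (x r))) =
      if r = (p, q) then ⟪stdBasis p, T (stdBasis q)⟫_ℂ else 0 := by
    classical
    rintro ⟨p', q'⟩
    rw [innerSL_apply_apply, ContinuousLinearMap.apply_apply, InnerProductSpace.rankOne_apply,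
        inner_smul_right,
      inner_smul_right, orthonormal_iff_ite.1 orthonormal_stdBasis,
      orthonormal_iff_ite.1 orthonormal_stdBasis]
    by_cases h1 : q' = q <;> by_cases h2 : p = p' <;> simp_all [eq_comm]
  simp only [h2]
  exact hasSum_ite_eq (p, q) _

/-- A weighted summable sequence has absolutely summable Hankel matrices: the pairs `(p, q)` with
`p - q = m` and exactly one of `p`, `q` negative are `|m|` in number. -/
theorem summable_hankel {w : ℤ → ℝ} (hw0 : ∀ m, 0 ≤ w m)
    (hw : Summable fun m : ℤ => (|(m : ℝ)| + 1) * w m) :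
    Summable fun r : ℤ × ℤ => if (0 ≤ r.1 ∧ r.2 < 0) ∨ (r.1 < 0 ∧ 0 ≤
        r.2) then w (r.1 - r.2) else 0 := by
  let e : ℤ × ℤ ≃ ℤ × ℤ :=
    { toFun := fun r => (r.1 + r.2, r.2)
      invFun := fun r => (r.1 - r.2, r.2)
      left_inv := fun r => by simp
      right_inv := fun r => by simp }
  rw [← e.summable_iff]
  have hz : ∀ (m q : ℤ), q ∉ Finset.Ico (-|m|) |m| →
      (if (0 ≤ m + q ∧ q < 0) ∨ (m + q < 0 ∧ 0 ≤ q) then w (m + q - q) else 0) = 0 := by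
    intro m q hq
    refine if_neg fun h => hq (Finset.mem_Ico.2 ?_)
    have h1 := le_abs_self m
    have h2 := neg_le_abs m
    omega
  refine (summable_prod_of_nonneg fun r => ?_).2 ⟨fun m => ?_, ?_⟩
  · dsimp only [Function.comp_apply, Pi.zero_apply]
    split_ifs
    exacts [hw0 _, le_rfl]
  · exact summable_of_ne_finset_zero (hz m)
  · refine Summable.of_nonneg_of_le (fun m => tsum_nonneg fun q => ?_) (fun m => ?_) (hw.mul_left 2)
    · dsimp only [Function.comp_apply]
      split_ifs
      exacts [hw0 _, le_rfl]
    · have h1 : ∑' q, (if (0 ≤ m + q ∧ q < 0) ∨ (m + q < 0 ∧ 0 ≤ q) then w (m + q - q) else 0) ≤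
          ∑ q ∈ Finset.Ico (-|m|) |m|, w m := by
        rw [tsum_eq_sum (hz m)]
        refine Finset.sum_le_sum fun q _ => ?_
        split_ifs
        · rw [add_sub_cancel_right]
        · exact hw0 m
      refine h1.trans ?_
      rw [Finset.sum_const, Int.card_Ico, nsmul_eq_mul]
      have h2 : (((|m| - -|m|).toNat : ℕ) : ℝ) = 2 * |(m : ℝ)| := by
        have h3 : ((|m| - -|m|).toNat : ℤ) = 2 * |m| := by
          have := abs_nonneg m
          omega
        have h4 : (((|m| - -|m|).toNat : ℤ) : ℝ) = ((2 * |m| : ℤ) : ℝ) := by rw [h3]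
        push_cast at h4
        exact h4
      rw [h2]
      nlinarith [hw0 m]

theorem norm_le_matNorm (A : Matrix (Fin N) (Fin N) ℂ) (i j : Fin N) : ‖A i j‖ ≤ matNorm A :=
  (Finset.single_le_sum (f := fun j => ‖A i j‖) (fun _ _ => norm_nonneg _)
      (Finset.mem_univ j)).trans
    (Finset.single_le_sum (f := fun i => ∑ j, ‖A i j‖)
      (fun _ _ => Finset.sum_nonneg fun _ _ => norm_nonneg _) (Finset.mem_univ i))

theorem matNorm_nonneg (A : Matrix (Fin N) (Fin N) ℂ) : 0 ≤ matNorm A :=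
  Finset.sum_nonneg fun _ _ => Finset.sum_nonneg fun _ _ => norm_nonneg _

theorem isTraceClass_of_le_hankel {a : MatFun N} (ha : a ∈ K11 N) {T : Ell2 N →L[ℂ] Ell2 N}
    (hT : ∀ p q : ℤ × Fin N, ‖⟪stdBasis p, T (stdBasis q)⟫_ℂ‖ ≤
      if (0 ≤ p.1 ∧ q.1 < 0) ∨ (p.1 < 0 ∧ 0 ≤ q.1) then matNorm (coeff a (p.1 - q.1)) else 0) :
    IsTraceClass T := by
  have h1 := (summable_hankel (fun m => matNorm_nonneg (coeff a m)) ha.2).mul_of_nonneg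
    (g := fun _ : Fin N × Fin N => (1 : ℝ)) (Summable.of_finite) (fun r => by
      dsimp only [Pi.zero_apply]
      split_ifs
      exacts [matNorm_nonneg _, le_rfl]) fun _ => zero_le_one
  rw [← (Equiv.prodProdProdComm ℤ (Fin N) ℤ (Fin N)).summable_iff] at h1
  refine isTraceClass_of_summable_entries (Summable.of_nonneg_of_le (fun _ => norm_nonneg _)
    (fun r => ?_) h1)
  simpa using hT r.1 r.2

theorem isTraceClass_P_comp_Q {a : MatFun N} (ha : a ∈ K11 N) {A : Ell2 N →L[ℂ] Ell2 N}
    (hA : IsLaurent a A) : IsTraceClass (P ∘L A ∘L Q) := by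
  refine isTraceClass_of_le_hankel ha fun p q => ?_
  rw [P, Q, inner_coordProj_comp, inner_laurent_stdBasis hA]
  simp only [Set.mem_ofPred_eq]
  by_cases h : 0 ≤ p.1 ∧ q.1 < 0
  · rw [if_pos h, if_pos (Or.inl h)]
    exact norm_le_matNorm _ _ _
  · rw [if_neg h, norm_zero]
    split_ifs
    exacts [matNorm_nonneg _, le_rfl]

theorem isTraceClass_Q_comp_P {a : MatFun N} (ha : a ∈ K11 N) {A : Ell2 N →L[ℂ] Ell2 N}
    (hA : IsLaurent a A) : IsTraceClass (Q ∘L A ∘L P) := by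
  refine isTraceClass_of_le_hankel ha fun p q => ?_
  rw [P, Q, inner_coordProj_comp, inner_laurent_stdBasis hA]
  simp only [Set.mem_ofPred_eq]
  by_cases h : p.1 < 0 ∧ 0 ≤ q.1
  · rw [if_pos h, if_pos (Or.inr h)]
    exact norm_le_matNorm _ _ _
  · rw [if_neg h, norm_zero]
    split_ifs
    exacts [matNorm_nonneg _, le_rfl]

theorem P_comp_comp_Q_eq_zero {a : MatFun N} (ha : a ∈ HInfMinus N) {A : Ell2 N →L[ℂ] Ell2 N}
    (hA : IsLaurent a A) : P ∘L A ∘L Q = 0 := by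
  refine ext_stdBasis fun p q => ?_
  rw [P, Q, inner_coordProj_comp, inner_laurent_stdBasis hA]
  split_ifs with h
  · rw [ha.2 _ (by have h1 : 0 ≤ p.1 := h.1; have h2 : q.1 < 0 := h.2; omega)]; simp
  · simp

theorem Q_comp_comp_P_eq_zero {a : MatFun N} (ha : a ∈ HInfPlus N) {A : Ell2 N →L[ℂ] Ell2 N}
    (hA : IsLaurent a A) : Q ∘L A ∘L P = 0 := by
  refine ext_stdBasis fun p q => ?_
  rw [P, Q, inner_coordProj_comp, inner_laurent_stdBasis hA]
  split_ifs with h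
  · rw [show p.1 - q.1 = -(q.1 - p.1) by ring,
      ha.2 _ (by have h1 : p.1 < 0 := h.1; have h2 : 0 ≤ q.1 := h.2; omega)]
    simp
  · simp

theorem exists_isLaurent_of_mem_K11 {a : MatFun N} (ha : a ∈ K11 N) :
    ∃ T : Ell2 N →L[ℂ] Ell2 N, IsLaurent a T := by
  refine exists_isLaurent (Summable.of_nonneg_of_le (fun n => matNorm_nonneg _) (fun n => ?_) ha.2)
  nlinarith [matNorm_nonneg (coeff a n), abs_nonneg (n : ℝ)]

end Laurent

section Diagonal

variable {N : ℕ}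

theorem det_finSection_diagonal_comp {F : Ell2 N →L[ℂ] Ell2 N} {f : ℤ → ℂ}
    (hF : ∀ x l, F x l = f l • x l) (T : Ell2 N →L[ℂ] Ell2 N) (S : Finset (ℤ × Fin N)) :
    (finSection (F ∘L T) S).det = (∏ p ∈ S, f p.1) * (finSection T S).det := by
  have h : finSection (F ∘L T) S = Matrix.diagonal (fun p : S => f p.1.1) * finSection T S := by
    ext p q
    rw [Matrix.diagonal_mul, finSection, finSection, Matrix.of_apply, Matrix.of_apply,
      ContinuousLinearMap.comp_apply, inner_stdBasis, inner_stdBasis, hF]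
    simp
  rw [h, Matrix.det_mul, Matrix.det_diagonal, Finset.prod_coe_sort S fun p => f p.1]

theorem isTraceClass_diagonal_sub_one {F : Ell2 N →L[ℂ] Ell2 N} {f : ℤ → ℂ}
    (hF : ∀ x l, F x l = f l • x l) {J : Finset ℤ} (hJ : ∀ l ∉ J,
        f l = 1) : IsTraceClass (F - 1) := by
  refine isTraceClass_of_summable_entries (summable_of_ne_finset_zero
    (s := (J ×ˢ Finset.univ) ×ˢ (J ×ˢ Finset.univ)) fun r hr => ?_)
  rw [norm_eq_zero, inner_stdBasis]
  have h1 : ((F - 1) (stdBasis r.2)) r.1.1 r.1.2 = (f r.1.1 - 1) * (stdBasis r.2 :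
      Ell2 N) r.1.1 r.1.2 := by
    rw [sub_apply, one_apply_eq_self, sub_mul, one_mul]
    change (F (stdBasis r.2)) r.1.1 r.1.2 - _ = _
    rw [hF]
    simp
  rw [h1, stdBasis_apply]
  split_ifs with h
  · by_cases h2 : r.1.1 ∈ J
    · exact absurd (by simp [← h, h2]) hr
    · simp [hJ _ h2]
  · simp

theorem BlockLaurent.HasFredholmDet.diagonal_comp {F : Ell2 N →L[ℂ] Ell2 N} {f : ℤ → ℂ}
    (hF : ∀ x l, F x l = f l • x l) {J : Finset ℤ} (hJ : ∀ l ∉ J, f l = 1)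
    {T : Ell2 N →L[ℂ] Ell2 N} {d : ℂ} (h : HasFredholmDet T d) :
    HasFredholmDet (F ∘L T) ((∏ l ∈ J, f l ^ N) * d) := by
  refine ⟨?_, ?_⟩
  · have h1 : F ∘L T - 1 = F ∘L (T - 1) + (F - 1) := by
      change F * T - 1 = F * (T - 1) + (F - 1)
      noncomm_ring
    rw [h1]
    exact (h.1.comp_left F).add (isTraceClass_diagonal_sub_one hF hJ)
  · refine (h.2.const_mul (∏ l ∈ J, f l ^ N)).congr' ?_
    filter_upwards [eventually_ge_atTop (J ×ˢ (Finset.univ : Finset (Fin N)))] with S hS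
    rw [det_finSection_diagonal_comp hF]
    congr 1
    rw [← Finset.prod_subset hS (fun p _ hp => hJ _ fun h => hp (by simp [h])), Finset.prod_product]
    simp

end Diagonal

section Factorization

variable {N : ℕ}

theorem Q_eq_one_sub_P : (Q : Ell2 N →L[ℂ] Ell2 N) = 1 - P := by
  refine ext_stdBasis fun p q => ?_
  rw [P, Q, sub_apply, inner_sub_right, inner_stdBasis_coordProj, inner_stdBasis_coordProj,
    one_apply_eq_self]
  by_cases h : 0 ≤ p.1
  · simp [h, not_lt.2 h]
  · simp [h, not_le.1 h]

theorem coordProj_mul_coordProj (S S' : Set ℤ) :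
    (coordProj S * coordProj S' : Ell2 N →L[ℂ] Ell2 N) = coordProj (S ∩ S') := by
  refine ext_stdBasis fun p q => ?_
  rw [mul_apply_eq_comp, inner_stdBasis_coordProj, inner_stdBasis_coordProj,
      inner_stdBasis_coordProj]
  by_cases h : p.1 ∈ S <;> by_cases h' : p.1 ∈ S' <;> simp [h, h']

theorem P_mul_P : (P * P : Ell2 N →L[ℂ] Ell2 N) = P := by
  rw [P, coordProj_mul_coordProj, Set.inter_self]

theorem hasFredholmDet_one_add_mul_comm {K : Ell2 N →L[ℂ] Ell2 N} (hK : IsTraceClass K)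
    (X : Ell2 N →L[ℂ] Ell2 N) {d : ℂ} :
    HasFredholmDet (1 + X * K) d ↔ HasFredholmDet (1 + K * X) d :=
  hasFredholmDet_mul_comm hK X

theorem BlockLaurent.HasFredholmDet.mul {T T' : Ell2 N →L[ℂ] Ell2 N} {d d' : ℂ}
    (h : HasFredholmDet T d) (h' : HasFredholmDet T' d') : HasFredholmDet (T * T') (d * d') :=
  h.comp h'

theorem BlockLaurent.IsTraceClass.mul_left {K : Ell2 N →L[ℂ] Ell2 N} (h : IsTraceClass K)
    (X : Ell2 N →L[ℂ] Ell2 N) : IsTraceClass (X * K) := h.comp_left X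

theorem BlockLaurent.IsTraceClass.mul_right {K : Ell2 N →L[ℂ] Ell2 N} (h : IsTraceClass K)
    (X : Ell2 N →L[ℂ] Ell2 N) : IsTraceClass (K * X) := h.comp_right X

theorem hasFredholmDet_one_add_of_comp_eq {K X : Ell2 N →L[ℂ] Ell2 N} (hK : IsTraceClass K)
    (h1 : X * K = K) (h2 : K * X = 0) : HasFredholmDet (1 + K) 1 := by
  have h := (hasFredholmDet_one_add_mul_comm hK X (d := 1)).2
  rw [h1, h2] at h
  refine h ⟨?_, ?_⟩
  · simpa using hK.smul 0
  · rw [add_zero]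
    refine tendsto_const_nhds.congr fun S => ?_
    have := det_finSection_sum_rankOne (ι := Empty) (N := N) (fun _ => 0) (fun _ => 0) ∅ S
    rw [Finset.sum_empty, add_zero] at this
    rw [this]
    simp [gramDet]

theorem toeplitz_identities {R : Type*} [Ring R] [Algebra ℂ R] {p q U U' M M' : R} (s : ℂ)
    (hQ : q = 1 - p) (hPP : p * p = p)
    (hUU' : U * U' = 1) (hU'U : U' * U = 1) (hM'M : M' * M = 1)
    (hQUP : q * U * p = 0) (hQU'P : q * U' * p = 0) (hPMQ : p * M * q = 0) (hPM'Q : p * M' * q = 0)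
    {V Z : R} (hV : V = s • p) (hZ : Z = M' * V * M - V) :
    q * p = 0 ∧ p + q = 1 ∧ p * U * p = U * p ∧ p * U' * p = U' * p ∧ p * V = V ∧ V * p = V ∧
      U' * V * U * p = V ∧ U * V * U' * p = V ∧ p * Z = 0 ∧ Z * p = Z ∧
      q * Z = s • (q - M' * q * M) ∧ q * Z = Z ∧ Z = s • ((q * M' * p) * M) := by
  have hqp : q * p = 0 := by linear_combination (norm := noncomm_ring) hQ * p - hPP
  have hpq : p + q = 1 := by rw [hQ]; abel
  have hUp : p * U * p = U * p := by
    linear_combination (norm := noncomm_ring) hpq * U * p - hQUP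
  have hU'p : p * U' * p = U' * p := by
    linear_combination (norm := noncomm_ring) hpq * U' * p - hQU'P
  have hM'p : p * M' * p = p * M' := by
    linear_combination (norm := noncomm_ring) p * M' * hpq - hPM'Q
  have hMp : p * M * p = p * M := by
    linear_combination (norm := noncomm_ring) p * M * hpq - hPMQ
  have hpV : p * V = V := by rw [hV, mul_smul_comm, hPP]
  have hVp : V * p = V := by rw [hV, smul_mul_assoc, hPP]
  have hqV : q * V = 0 := by rw [hV, mul_smul_comm, hqp, smul_zero]
  have hU'VUp : U' * V * U * p = V := by
    rw [hV, mul_smul_comm, smul_mul_assoc, smul_mul_assoc]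
    congr 1
    linear_combination (norm := noncomm_ring) U' * hUp + hU'U * p
  have hUVU'p : U * V * U' * p = V := by
    rw [hV, mul_smul_comm, smul_mul_assoc, smul_mul_assoc]
    congr 1
    linear_combination (norm := noncomm_ring) U * hU'p + hUU' * p
  have hpM'VM : p * M' * V * M = V := by
    rw [hV, mul_smul_comm, smul_mul_assoc]
    congr 1
    linear_combination (norm := noncomm_ring) hM'p * M + p * hM'M
  have hVMp : V * M * p = V * M := by
    rw [hV, smul_mul_assoc, smul_mul_assoc, hMp]
  have hpZ : p * Z = 0 := by
    linear_combination (norm := noncomm_ring) p * hZ + hpM'VM - hpV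
  have hZp : Z * p = Z := by
    linear_combination (norm := noncomm_ring) hZ * p - hZ + M' * hVMp - hVp
  have hqZ : q * Z = s • (q - M' * q * M) := by
    have h1 : q * M' * p * M = q - M' * q * M := by
      linear_combination (norm := noncomm_ring)
        q * M' * hpq * M + q * hM'M - hpq * M' * q * M + hPM'Q * M
    rw [hZ, mul_sub, hqV, sub_zero, ← h1, hV]
    simp only [mul_smul_comm, smul_mul_assoc, mul_assoc]
  have hZ' : q * Z = Z := by
    linear_combination (norm := noncomm_ring) hpq * Z - hpZ
  have hZ'' : Z = s • ((q * M' * p) * M) := by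
    rw [← hZ', hZ, mul_sub, hqV, sub_zero, hV]
    simp only [mul_smul_comm, smul_mul_assoc, mul_assoc]
  exact ⟨hqp, hpq, hUp, hU'p, hpV, hVp, hU'VUp, hUVU'p, hpZ, hZp, hqZ, hZ', hZ''⟩

theorem toeplitz_compression_identities {R : Type*} [Ring R] [Algebra ℂ R] {p q U U' M M' D :
    R} {s : ℂ}
    (hQ : q = 1 - p) (hPP : p * p = p)
    (hUU' : U * U' = 1) (hU'U : U' * U = 1) (hM'M : M' * M = 1)
    (hQUP : q * U * p = 0) (hQU'P : q * U' * p = 0) (hPMQ : p * M * q = 0) (hPM'Q : p * M' * q = 0)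
    (hPD : p * D = D) (hDP : D * p = D)
    {V Z W K₀ K₁ X : R} (hV : V = s • p) (hZ : Z = M' * V * M - V) (hW : W = U * D * U')
    (hK₀ : K₀ = V - W * p + W * q * Z) (hK₁ : K₁ = U' * K₀ * U) (hX : X = U' * M' * q * M * U) :
    p * W = W ∧ W * q = (U * D) * (p * U' * q) ∧ K₀ = U * (V - D) * (U' * p) + W * q * Z ∧
      p * K₁ = K₁ ∧ K₁ * p = V - D - s • (D * X * p) ∧
      (1 + -(W * q)) * (1 + K₀) * (1 + Z) = 1 + (V + Z - W) := by
  obtain ⟨hqp, hpq, hUp, hU'p, hpV, hVp, hU'VUp, hUVU'p, hpZ, hZp, hqZ, -, -⟩ :=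
    toeplitz_identities s hQ hPP hUU' hU'U hM'M hQUP hQU'P hPMQ hPM'Q hV hZ
  have hpW : p * W = W := by
    linear_combination (norm := noncomm_ring)
      (p * hW - hW - p * U * hPD * U' + U * hPD * U' + hUp * D * U')
  have hWq : W * q = (U * D) * (p * U' * q) := by
    linear_combination (norm := noncomm_ring) hW * q - U * hDP * U' * q
  have hK₀' : K₀ = U * (V - D) * (U' * p) + W * q * Z := by
    linear_combination (norm := noncomm_ring) hK₀ - hUVU'p - hW * p
  have hpK₀ : p * K₀ = K₀ := by
    linear_combination (norm := noncomm_ring) p * hK₀ - hK₀ + hpV - hpW * p + hpW * q * Z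
  have hpK₁ : p * K₁ = K₁ := by
    linear_combination (norm := noncomm_ring)
      p * hK₁ - hK₁ - p * U' * hpK₀ * U + U' * hpK₀ * U + hU'p * K₀ * U
  have hK₁p : K₁ * p = V - D - s • (D * X * p) := by
    have h1 : K₁ * p = V - D + D * U' * (q * Z) * U * p := by
      linear_combination (norm := noncomm_ring) hK₁ * p + U' * hK₀ * U * p + hU'VUp
        - U' * hW * p * U * p + U' * hW * q * Z * U * p
        - hU'U * D * U' * p * U * p + hU'U * D * U' * q * Z * U * p
        - D * U' * hUp - D * hU'U * p - hDP
    have h2 : D * U' * (q - M' * q * M) * U * p = - (D * X * p) := by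
      linear_combination (norm := noncomm_ring) D * hX * p + D * U' * hQUP
    rw [h1, hqZ, mul_smul_comm, smul_mul_assoc, smul_mul_assoc, h2, smul_neg, ← sub_eq_add_neg]
  have hqK₀ : q * K₀ = 0 := by
    linear_combination (norm := noncomm_ring) hqp * K₀ - q * hpK₀
  have h1 : (1 + -(W * q)) * (1 + K₀) = 1 + V - W + W * q * Z := by
    linear_combination (norm := noncomm_ring) hK₀ - W * hpq - W * hqK₀
  have h2 : (1 + V - W + W * q * Z) * (1 + Z) = 1 + (V + Z - W) := by
    linear_combination (norm := noncomm_ring) V * hpZ - hVp * Z + W * hpq * Z - W * hpZ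
      + W * q * Z * hpZ - W * q * hZp * Z
  exact ⟨hpW, hWq, hK₀', hpK₁, hK₁p, by rw [h1, h2]⟩

theorem hasFredholmDet_of_factorization {U U' M M' D E F : Ell2 N →L[ℂ] Ell2 N} {s c : ℂ}
    (hUU' : U * U' = 1) (hU'U : U' * U = 1) (hMM' : M * M' = 1) (hM'M : M' * M = 1)
    (hQUP : Q * U * P = 0) (hQU'P : Q * U' * P = 0) (hPMQ : P * M * Q = 0) (hPM'Q : P * M' * Q = 0)
    (hPU'Q : IsTraceClass (P * U' * Q)) (hQM'P : IsTraceClass (Q * M' * P))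
    (hPD : P * D = D) (hDP : D * P = D) (hPE : P * E = E) (hEP : E * P = E)
    (hD : IsTraceClass (s • P - D)) (hF : F = 1 + s • P - D) (hFE : F * E = s • D)
    (hdet : ∀ (T : Ell2 N →L[ℂ] Ell2 N) d, HasFredholmDet T d → HasFredholmDet (F * T) (c * d)) :
    ∃ d, HasFredholmDet (1 - E * U' * M' * Q * M * U) d ∧
      HasFredholmDet (1 + s • P - M * U * D * U' * M') (c * d) := by
  have hQ := Q_eq_one_sub_P (N := N)
  have hPP := P_mul_P (N := N)
  generalize (P : Ell2 N →L[ℂ] Ell2 N) = p at *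
  generalize (Q : Ell2 N →L[ℂ] Ell2 N) = q at *
  obtain ⟨V, hV⟩ : ∃ T, T = s • p := ⟨_, rfl⟩
  rw [← hV] at hD hF ⊢
  obtain ⟨X, hX⟩ : ∃ T, T = U' * M' * q * M * U := ⟨_, rfl⟩
  obtain ⟨Z, hZ⟩ : ∃ T, T = M' * V * M - V := ⟨_, rfl⟩
  obtain ⟨W, hW⟩ : ∃ T, T = U * D * U' := ⟨_, rfl⟩
  obtain ⟨K₀, hK₀⟩ : ∃ T, T = V - W * p + W * q * Z := ⟨_, rfl⟩
  obtain ⟨K₁, hK₁⟩ : ∃ T, T = U' * K₀ * U := ⟨_, rfl⟩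
  obtain ⟨hqp, hpq, hUp, hU'p, hpV, hVp, hU'VUp, hUVU'p, hpZ, hZp, hqZ, hZ', hZ''⟩ :=
    toeplitz_identities s hQ hPP hUU' hU'U hM'M hQUP hQU'P hPMQ hPM'Q hV hZ
  obtain ⟨hpW, hWq, hK₀', hpK₁, hK₁p, h5⟩ := toeplitz_compression_identities hQ hPP hUU' hU'U hM'M
    hQUP hQU'P hPMQ hPM'Q hPD hDP hV hZ hW hK₀ hK₁ hX
  have hZtc : IsTraceClass Z := by
    rw [hZ'']
    exact (hQM'P.mul_right M).smul s
  have hYtc : IsTraceClass (-(W * q)) := by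
    rw [hWq]
    exact (hPU'Q.mul_left _).neg
  have hK₀tc : IsTraceClass K₀ := by
    rw [hK₀']
    exact ((hD.mul_left U).mul_right _).add (hZtc.mul_left _)
  have hEX : IsTraceClass (E * X) := by
    have h1 : E * X = E * (p * U' * q) * (M' * q * M * U) := by
      linear_combination (norm := noncomm_ring) E * hX - hEP * U' * M' * q * M * U
        + E * p * U' * hPM'Q * M * U - E * p * U' * hpq * M' * q * M * U
    rw [h1]
    exact (hPU'Q.mul_left E).mul_right _
  have hK₁tc : IsTraceClass K₁ := by
    rw [hK₁]
    exact (hK₀tc.mul_left U').mul_right U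
  obtain ⟨d, hd⟩ := hEX.neg.exists_hasFredholmDet
  refine ⟨d, ?_, ?_⟩
  · have h1 : 1 - E * U' * M' * q * M * U = 1 + -(E * X) := by
      linear_combination (norm := noncomm_ring) E * hX
    rwa [h1]
  have d1 : HasFredholmDet (1 + -(E * X) * p) d := by
    refine (hasFredholmDet_one_add_mul_comm hEX.neg p).1 ?_
    have h1 : p * -(E * X) = -(E * X) := by
      linear_combination (norm := noncomm_ring) -hPE * X
    rwa [h1]
  have d2 : HasFredholmDet (1 + K₁ * p) (c * d) := by
    have h1 : F * (1 + -(E * X) * p) = 1 + K₁ * p := by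
      have h2 : F * (1 + -(E * X) * p) = F - (F * E) * X * p := by noncomm_ring
      rw [h2, hFE, hK₁p, hF, smul_mul_assoc, smul_mul_assoc]
      abel
    rw [← h1]
    exact hdet _ _ d1
  have d3 : HasFredholmDet (1 + K₁) (c * d) := by
    rw [← hpK₁]
    exact (hasFredholmDet_one_add_mul_comm hK₁tc p).2 d2
  have d4 : HasFredholmDet (1 + K₀) (c * d) := by
    have h1 : K₀ = U * (K₁ * U') := by
      linear_combination (norm := noncomm_ring) - U * hK₁ * U' - hUU' * K₀ * U * U' - K₀ * hUU'
    have h2 : K₁ * U' * U = K₁ := by linear_combination (norm := noncomm_ring) K₁ * hU'U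
    rw [h1]
    refine (hasFredholmDet_one_add_mul_comm (K := K₁ * U')
      (hK₁tc.mul_right U') U).2 ?_
    rwa [h2]
  have dY : HasFredholmDet (1 + -(W * q)) 1 := by
    refine hasFredholmDet_one_add_of_comp_eq (X := p) hYtc ?_ ?_
    · linear_combination (norm := noncomm_ring) -hpW * q
    · linear_combination (norm := noncomm_ring) -W * hqp
  have dZ : HasFredholmDet (1 + Z) 1 := by
    refine hasFredholmDet_one_add_of_comp_eq (X := q) hZtc hZ' ?_
    linear_combination (norm := noncomm_ring) Z * hpq - hZp
  have d5 := (dY.mul d4).mul dZ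
  rw [one_mul, mul_one] at d5
  rw [h5] at d5
  have htc : IsTraceClass (V + Z - W) := by
    have h := d5.1
    rwa [add_sub_cancel_left] at h
  have h6 : 1 + V - M * U * D * U' * M' = 1 + M * ((V + Z - W) * M') := by
    linear_combination (norm := noncomm_ring) - M * hZ * M' + M * hW * M'
      - hMM' * V * M * M' - V * hMM'
  rw [h6]
  refine (hasFredholmDet_one_add_mul_comm (htc.mul_right M') M).2 ?_
  have h7 : (V + Z - W) * M' * M = V + Z - W := by
    linear_combination (norm := noncomm_ring) (V + Z - W) * hM'M
  rwa [h7]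

end Factorization

section Combinatorics

@[to_additive]
theorem Fin.prod_ite_castSucc_lt_succ {M : Type*} [CommMonoid M] {k : ℕ} (h : Fin k →
    M) (j : Fin k) :
    (∏ i : Fin k, if i.castSucc < j.succ then h i else 1) =
      (∏ i : Fin k, if i.castSucc < j.castSucc then h i else 1) * h j := by
  rw [← Finset.mul_prod_erase _ _ (Finset.mem_univ j),
    ← Finset.mul_prod_erase Finset.univ (fun i => if i.castSucc < j.castSucc then h i else 1)
        (Finset.mem_univ j)]
  rw [if_pos (Fin.castSucc_lt_succ), if_neg (lt_irrefl _), one_mul, mul_comm]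
  congr 1
  refine Finset.prod_congr rfl fun i hi => ?_
  have hij : i ≠ j := (Finset.mem_erase.1 hi).1
  have : i.castSucc < j.succ ↔ i.castSucc < j.castSucc := by
    have := Fin.val_ne_of_ne hij
    simp only [Fin.lt_def, Fin.val_castSucc, Fin.val_succ]
    omega
  simp only [this]

theorem Fin.sum_ite_castSucc_lt_sub {k : ℕ} (s : Fin (k + 1) → ℂ) (j : Fin (k + 1)) :
    (∑ i : Fin k, if i.castSucc < j then s i.succ - s i.castSucc else 0) = s j - s 0 := by
  induction j using Fin.induction with
  | zero => simp
  | succ j ih => rw [Fin.sum_ite_castSucc_lt_succ, ih]; ring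

theorem Fin.prod_ite_castSucc_lt_Ico {k : ℕ} {n : Fin (k + 1) → ℕ} (hn0 : n 0 = 0) (hn : Monotone n)
    (g : ℤ → ℂ) (j : Fin (k + 1)) :
    (∏ i : Fin k, if i.castSucc < j then ∏ l ∈ Finset.Ico (n i.castSucc : ℤ) (n i.succ),
        g l else 1) =
      ∏ l ∈ Finset.Ico (0 : ℤ) (n j), g l := by
  induction j using Fin.induction with
  | zero => simp [hn0]
  | succ j ih =>
    rw [Fin.prod_ite_castSucc_lt_succ, ih]
    have h : (n j.castSucc : ℤ) ≤ n j.succ := by exact_mod_cast hn Fin.castSucc_lt_succ.le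
    rw [← Finset.prod_union (Finset.Ico_disjoint_Ico_consecutive _ _ _),
        Finset.Ico_union_Ico_eq_Ico (by positivity) h]

theorem Fin.exists_max_le {k : ℕ} {n : Fin (k + 1) → ℕ} (hn0 : n 0 = 0) {l : ℤ} (hl : 0 ≤ l) :
    ∃ j, (n j : ℤ) ≤ l ∧ ∀ i, (n i : ℤ) ≤ l → i ≤ j := by
  classical
  let S : Finset (Fin (k + 1)) := Finset.univ.filter fun i => (n i : ℤ) ≤ l
  have hS : S.Nonempty := ⟨0, by simp [S, hn0, hl]⟩
  exact ⟨S.max' hS, (Finset.mem_filter.1 (S.max'_mem hS)).2,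
    fun i hi => S.le_max' i (by simp [S, hi])⟩

theorem mem_interval_iff {k : ℕ} {n : Fin (k + 1) → ℕ} (hn : Monotone n) {l : ℤ} {j : Fin (k + 1)}
    (hj : (n j : ℤ) ≤ l) (hmax : ∀ i, (n i : ℤ) ≤ l → i ≤ j) (i : Fin (k + 1)) :
    l ∈ interval n i ↔ i = j := by
  constructor
  · rintro ⟨h1, h2⟩
    refine le_antisymm (hmax i h1) (not_lt.1 fun h => ?_)
    have h3 : (i : ℕ) + 1 < k + 1 := lt_of_le_of_lt h j.2
    have h4 := h2 ⟨i + 1, h3⟩ rfl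
    have h5 : n ⟨i + 1, h3⟩ ≤ n j := hn (Fin.le_def.2 h)
    omega
  · rintro rfl
    refine ⟨hj, fun m hm => not_le.1 fun h => ?_⟩
    have := Fin.le_def.1 (hmax m h)
    omega

end Combinatorics

section Main

variable {N k : ℕ}

open Classical in
theorem sum_smul_coordProj_apply {ι : Type*} [Fintype ι] (c : ι → ℂ) (S : ι → Set ℤ) (x : Ell2 N)
    (l : ℤ) : (∑ i, c i • coordProj (S i)) x l = (∑ i, if l ∈ S i then c i else 0) • x l := by
  have h : (∑ i, c i • coordProj (S i)) x l = ∑ i, c i • (coordProj (S i) x l) := by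
    have := congrArg (lp.evalCLM ℂ (fun _ : ℤ => EuclideanSpace ℂ (Fin N)) 2 l)
      (sum_apply (Finset.univ) (fun i => c i • coordProj (S i)) x)
    rw [map_sum] at this
    exact this
  rw [h, Finset.sum_smul]
  refine Finset.sum_congr rfl fun i _ => ?_
  rw [coordProj_apply]
  split_ifs <;> simp

theorem eq_of_diagonal {T T' : Ell2 N →L[ℂ] Ell2 N} {f : ℤ → ℂ} (h : ∀ x l, T x l = f l • x l)
    (h' : ∀ x l, T' x l = f l • x l) : T = T' := by
  ext1 x
  ext1
  funext l
  rw [h, h']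

theorem diagonal_mul {T T' : Ell2 N →L[ℂ] Ell2 N} {f f' : ℤ → ℂ} (h : ∀ x l, T x l = f l • x l)
    (h' : ∀ x l, T' x l = f' l • x l) (x : Ell2 N) (l : ℤ) : (T * T') x l = (f l * f' l) • x l := by
  rw [mul_apply_eq_comp, h, h', smul_smul]

theorem exists_factors_of_mem_PhiR {a : MatFun N} (ha : a ∈ PhiR (K11 N)) :
    ∃ U U' M M' : Ell2 N →L[ℂ] Ell2 N, L a = M * U ∧ L a⁻¹ = U' * M' ∧ U * U' = 1 ∧ U' * U = 1 ∧
      M * M' = 1 ∧ M' * M = 1 ∧ Q * U * P = 0 ∧ Q * U' * P = 0 ∧ P * M * Q = 0 ∧ P * M' * Q = 0 ∧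
      IsTraceClass (P * U' * Q) ∧ IsTraceClass (Q * M' * P) := by
  obtain ⟨-, um, up, hum, hup, ⟨hm, hm0⟩, ⟨hm', hm0'⟩, ⟨hp, hp0⟩, ⟨hp', hp0'⟩, heq⟩ := ha
  obtain ⟨U, hU⟩ := exists_isLaurent_of_mem_K11 hp
  obtain ⟨U', hU'⟩ := exists_isLaurent_of_mem_K11 hp'
  obtain ⟨M, hM⟩ := exists_isLaurent_of_mem_K11 hm
  obtain ⟨M', hM'⟩ := exists_isLaurent_of_mem_K11 hm'
  have hinv : ∀ (b : MatFun N), (∀ᵐ t ∂(AddCircle.haarAddCircle (T := (1 : ℝ))), IsUnit (b t)) →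
      b * b⁻¹ =ᵐ[AddCircle.haarAddCircle] 1 ∧ b⁻¹ * b =ᵐ[AddCircle.haarAddCircle] 1 := fun b hb =>
    ⟨hb.mono fun t ht => Matrix.mul_nonsing_inv _ ((Matrix.isUnit_iff_isUnit_det _).1 ht),
      hb.mono fun t ht => Matrix.nonsing_inv_mul _ ((Matrix.isUnit_iff_isUnit_det _).1 ht)⟩
  have hMU : IsLaurent a (M ∘L U) := (hM.mul hU hm.1 hp.1).congr (heq.mono fun t ht => ht.symm)
  have hU'M' : IsLaurent a⁻¹ (U' ∘L M') := (hU'.mul hM' hp'.1 hm'.1).congr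
    (heq.mono fun t ht => by
      change (up t)⁻¹ * (um t)⁻¹ = (a t)⁻¹
      rw [ht, Matrix.mul_inv_rev])
  exact ⟨U, U', M, M', (isLaurent_L ⟨_, hMU⟩).unique hMU, (isLaurent_L ⟨_, hU'M'⟩).unique hU'M',
    ((hU.mul hU' hp.1 hp'.1).congr (hinv up hup).1).unique isLaurent_one,
    ((hU'.mul hU hp'.1 hp.1).congr (hinv up hup).2).unique isLaurent_one,
    ((hM.mul hM' hm.1 hm'.1).congr (hinv um hum).1).unique isLaurent_one,
    ((hM'.mul hM hm'.1 hm.1).congr (hinv um hum).2).unique isLaurent_one,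
    Q_comp_comp_P_eq_zero hp0 hU, Q_comp_comp_P_eq_zero hp0' hU',
    P_comp_comp_Q_eq_zero hm0 hM, P_comp_comp_Q_eq_zero hm0' hM',
    isTraceClass_P_comp_Q hp' hU', isTraceClass_Q_comp_P hm' hM'⟩

end Main

end

theorem theorem5 (N k : ℕ) (n : Fin (k + 1) → ℕ) (hn0 : n 0 = 0) (hn : Monotone n)
    (s : Fin (k + 1) → ℂ) (hs0 : s 0 = 0)
    (hs : ∀ j : Fin k, s (Fin.last k) - s j.succ ≠ -1)
    (a : MatFun N) (ha : a ∈ PhiR (K11 N)) :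
    ∃ d : ℂ,
      HasFredholmDet
        (1 - (∑ j : Fin k, (s (Fin.last k) * s j.succ / (1 + s (Fin.last k) - s j.succ)) •
          intervalProj n j.succ) ∘L L a⁻¹ ∘L Q ∘L L a) d ∧
      HasFredholmDet
        (1 + ∑ j : Fin k, (s j.succ - s j.castSucc) •
          (P - L a ∘L Qn (n j.succ) ∘L L a⁻¹))
        ((∏ j : Fin k,
          (1 + s (Fin.last k) - s j.castSucc) ^ (N * (n j.succ - n j.castSucc))) * d) := by
  classical
  obtain ⟨U, U', M, M', hA, hA', hUU', hU'U, hMM', hM'M, hQUP, hQU'P, hPMQ, hPM'Q, hPU'Q, hQM'P⟩ :=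
    exists_factors_of_mem_PhiR ha
  set σ := s (Fin.last k) with hσ
  let e : Fin (k + 1) → ℂ := fun j => σ * s j / (1 + σ - s j)
  let D : Ell2 N →L[ℂ] Ell2 N := ∑ j : Fin k, (s j.succ - s j.castSucc) • Qn (n j.succ)
  let E : Ell2 N →L[ℂ] Ell2 N := ∑ j : Fin k, e j.succ • intervalProj n j.succ
  let δ : ℤ → ℂ := fun l => ∑ j : Fin k,
    if l ∈ {m : ℤ | (n j.succ : ℤ) ≤ m} then s j.succ - s j.castSucc else 0
  let ε : ℤ → ℂ := fun l => ∑ j : Fin k, if l ∈ interval n j.succ then e j.succ else 0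
  let π : ℤ → ℂ := fun l => if 0 ≤ l then 1 else 0
  have hD : ∀ (x : Ell2 N) l, D x l = δ l • x l := fun x l => by
    convert sum_smul_coordProj_apply (fun j : Fin k => s j.succ - s j.castSucc)
      (fun j => {m : ℤ | (n j.succ : ℤ) ≤ m}) x l
    rfl
  have hE : ∀ (x : Ell2 N) l, E x l = ε l • x l := sum_smul_coordProj_apply _ _
  have hP : ∀ (x : Ell2 N) l, P x l = π l • x l := fun x l => by
    rw [P, coordProj_apply]
    by_cases h : 0 ≤ l <;> simp [π, h]
  have hneg : ∀ l < 0, δ l = 0 ∧ ε l = 0 := fun l hl =>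
    ⟨Finset.sum_eq_zero fun j _ => if_neg fun h => by
      have : (n j.succ : ℤ) ≤ l := h
      omega,
     Finset.sum_eq_zero fun j _ => if_neg fun h => by
      have := h.1
      omega⟩
  have hδ : ∀ {l : ℤ} {j : Fin (k + 1)}, (n j : ℤ) ≤ l → (∀ i,
      (n i : ℤ) ≤ l → i ≤ j) → δ l = s j := by
    intro l j hj hmax
    rw [← sub_zero (s j), ← hs0, ← Fin.sum_ite_castSucc_lt_sub]
    refine Finset.sum_congr rfl fun i _ => ?_
    have : l ∈ {m : ℤ | (n i.succ : ℤ) ≤ m} ↔ i.castSucc < j := by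
      rw [Fin.castSucc_lt_iff_succ_le]
      refine ⟨fun h => hmax _ h, fun h => ?_⟩
      have := hn h
      change (n i.succ : ℤ) ≤ l
      omega
    simp only [this]
  have hε : ∀ {l : ℤ} {j : Fin (k + 1)}, (n j : ℤ) ≤ l → (∀ i,
      (n i : ℤ) ≤ l → i ≤ j) → ε l = e j := by
    intro l j hj hmax
    simp only [ε, mem_interval_iff hn hj hmax]
    cases j using Fin.cases with
    | zero => simp [e, hs0, Fin.succ_ne_zero]
    | succ j => simp
  let φ : ℤ → ℂ := fun l => 1 + σ * π l - δ l
  let F : Ell2 N →L[ℂ] Ell2 N := 1 + σ • P - D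
  have hVD : ∀ (x : Ell2 N) l, (σ • P - D : Ell2 N →L[ℂ] Ell2 N) x l =
      (σ * π l - δ l) • x l := fun x l => by
    rw [sub_smul, mul_smul, ← hP, ← hD]
    rfl
  have hF : ∀ (x : Ell2 N) l, F x l = φ l • x l := fun x l => by
    have : F = 1 + (σ • P - D) := by simp only [F]; abel
    simp only [φ]
    rw [add_sub_assoc, add_smul, ← hVD, one_smul, this]
    rfl
  have hφ1 : ∀ l ∉ Finset.Ico (0 : ℤ) (n (Fin.last k)), φ l = 1 := by
    intro l hl
    by_cases h0 : 0 ≤ l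
    · have h1 : (n (Fin.last k) : ℤ) ≤ l := by
        rw [Finset.mem_Ico] at hl
        omega
      simp only [φ, π, if_pos h0, hδ h1 fun i _ => Fin.le_last i, hσ]
      ring
    · simp [φ, π, h0, (hneg l (not_le.1 h0)).1]
  have hFE : F * E = σ • D := by
    refine eq_of_diagonal (diagonal_mul hF hE) fun x l => ?_
    have h1 : φ l * ε l = σ * δ l := by
      rcases lt_or_ge l 0 with h | h
      · simp [hneg l h]
      · obtain ⟨j, hj, hmax⟩ := Fin.exists_max_le hn0 h
        simp only [φ, π, if_pos h, hδ hj hmax, hε hj hmax, e, mul_one]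
        cases j using Fin.cases with
        | zero => simp [hs0]
        | succ j =>
          have h2 : 1 + σ - s j.succ ≠ 0 := fun h => hs j (by linear_combination h)
          field_simp
    rw [h1, mul_smul, ← hD]
    rfl
  have hprod : ∏ l ∈ Finset.Ico (0 : ℤ) (n (Fin.last k)), φ l ^ N =
      ∏ j : Fin k, (1 + σ - s j.castSucc) ^ (N * (n j.succ - n j.castSucc)) := by
    rw [← Fin.prod_ite_castSucc_lt_Ico hn0 hn]
    refine Finset.prod_congr rfl fun i _ => ?_
    rw [if_pos (Fin.castSucc_lt_last i), Finset.prod_congr rfl (g := fun _ => (1 +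
        σ - s i.castSucc) ^ N),
      Finset.prod_const, Int.card_Ico, ← pow_mul]
    · congr 2
      omega
    · intro l hl
      rw [Finset.mem_Ico] at hl
      have h0 : 0 ≤ l := le_trans (by positivity) hl.1
      have hmax : ∀ j, (n j : ℤ) ≤ l → j ≤ i.castSucc := fun j hj => not_lt.1 fun h => by
        have := hn (Fin.castSucc_lt_iff_succ_le.1 h)
        omega
      simp only [φ, π, if_pos h0, hδ hl.1 hmax, mul_one]
  have hπ : ∀ (l : ℤ) (f : ℤ → ℂ), (∀ m < 0, f m = 0) → π l * f l = f l := fun l f hf => by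
    by_cases h : 0 ≤ l
    · simp [π, h]
    · simp [π, h, hf l (not_le.1 h)]
  have hVDtc : IsTraceClass (σ • P - D) := by
    have h := isTraceClass_diagonal_sub_one hF hφ1
    have h1 : F - 1 = σ • P - D := by simp only [F]; abel
    rwa [h1] at h
  obtain ⟨d, hd1, hd2⟩ := hasFredholmDet_of_factorization (D := D) (E := E) (F := F) (s := σ)
    (c := ∏ l ∈ Finset.Ico (0 : ℤ) (n (Fin.last k)), φ l ^ N) hUU' hU'U hMM' hM'M hQUP hQU'P hPMQ
    hPM'Q hPU'Q hQM'P
    (eq_of_diagonal (diagonal_mul hP hD) fun x l => by rw [hπ l δ fun m hm => (hneg m hm).1, hD])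
    (eq_of_diagonal (diagonal_mul hD hP) fun x l => by
      rw [mul_comm, hπ l δ fun m hm => (hneg m hm).1, hD])
    (eq_of_diagonal (diagonal_mul hP hE) fun x l => by rw [hπ l ε fun m hm => (hneg m hm).2, hE])
    (eq_of_diagonal (diagonal_mul hE hP) fun x l => by
      rw [mul_comm, hπ l ε fun m hm => (hneg m hm).2, hE])
    hVDtc rfl hFE fun T d h => h.diagonal_comp hF hφ1
  refine ⟨d, ?_, ?_⟩
  · have h1 : E * U' * M' * Q * M * U = E ∘L L a⁻¹ ∘L Q ∘L L a := by
      rw [hA, hA']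
      simp only [← ContinuousLinearMap.mul_def, mul_assoc]
    rwa [h1] at hd1
  · have h1 : 1 + σ • P - M * U * D * U' * M' = 1 + ∑ j : Fin k, (s j.succ - s j.castSucc) •
        (P - L a ∘L Qn (n j.succ) ∘L L a⁻¹) := by
      have h2 : ∑ j : Fin k, (s j.succ - s j.castSucc) = σ := by
        have := Fin.sum_ite_castSucc_lt_sub s (Fin.last k)
        simpa [Fin.castSucc_lt_last, hs0] using this
      have h3 : M * U * D * U' * M' = L a * D * L a⁻¹ := by
        rw [hA, hA']
        simp only [mul_assoc]
      rw [h3, add_sub_assoc]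
      congr 1
      simp only [smul_sub, Finset.sum_sub_distrib, ← Finset.sum_smul, h2]
      congr 1
      simp only [D, Finset.mul_sum, Finset.sum_mul, mul_smul_comm, smul_mul_assoc,
        ← ContinuousLinearMap.mul_def, mul_assoc]
    rw [h1, hprod] at hd2
    exact hd2
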